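/- Let $X$ be a smooth projective toric variety over an algebraically closed field $k$, with Cox ring $S$ (a polynomial ring graded by $\operatorname{Pic}(X)$) and irrelevant ideal $B$. Let $M$ be a finitely generated $\operatorname{Pic}(X)$-graded $S$-module with associated sheaf $\widetilde M$ on $X$. A virtual resolution of $M$ is a complex $F_0\leftarrow F_1\leftarrow\cdots$ of finitely generated free $\operatorname{Pic}(X)$-graded $S$-modules whose associated complex of sheaves is a locally free resolution of $\widetilde M$; $\operatorname{vdim} M$ is the minimal length of a virtual resolution of $M$; $\operatorname{codim} M$ is the codimension of $\operatorname{Spec}(S/\operatorname{Ann} M)$ in $\operatorname{Spec} S$; and $M$ is virtually Cohen--Macaulay if $\widetilde M\neq 0$ and $\operatorname{vdim} M=\operatorname{codim} M$. A module is $B$-saturated if it has no nonzero element killed by a power of $B$. An ideal is relevant if it contains no power $B^t$, $t\ge 1$, and an ideal $I$ is unmixed if $\dim S/P=\dim S/I$ for every associated prime $P$ of $S/I$. Suppose that $M$ is virtually Cohen--Macaulay. Then: (a) If $M$ is $B$-saturated, then $\dim S/P=\dim M$ for every associated prime $P$ of $M$. (b) $M$ is virtually unmixed, that is: (1) $\dim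 S/P=\dim M$ for every relevant associated prime $P$ of $M$; (2) for every $B$-saturated $\operatorname{Pic}(X)$-graded $S$-module $N$ with $\widetilde N\cong\widetilde M$, $\dim S/P=\dim N$ for every associated prime $P$ of $N$; (3) the $B$-saturation $(\operatorname{Ann}_S M:B^\infty)$ is an unmixed ideal; (4) for every $N$ as in (2), $\operatorname{Ann}_S N$ is an unmixed ideal. -/

import Mathlib

universe v

/-- The convex cone in `ℝⁿ` generated by the lattice vectors `gen ρ`, `ρ ∈ σ`. -/
noncomputable def latticeCone {n : ℕ} {ι : Type*} (gen : ι → Fin n → ℤ) (σ : Finset ι) :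
    PointedCone ℝ (Fin n → ℝ) :=
  PointedCone.hull ℝ ((fun ρ i => (gen ρ i : ℝ)) '' (σ : Set ι))

/-- A smooth projective toric variety, given by its fan in the lattice `N = ℤⁿ`.  The rays of the
fan are indexed by `ι`, `gen ρ` is the primitive generator of the ray `ρ`, and a cone of the fan is
recorded by the finite set of its rays (every smooth cone is simplicial). -/
structure SmoothProjectiveFan (n : ℕ) (ι : Type*) [Fintype ι] [DecidableEq ι] where
  /-- The primitive generators of the rays. -/
  gen : ι → Fin n → ℤ
  /-- The cones of the fan, as sets of rays. -/
  cones : Finset (Finset ι)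
  empty_mem : ∅ ∈ cones
  ray_mem : ∀ ρ, {ρ} ∈ cones
  face_mem : ∀ σ ∈ cones, ∀ τ ⊆ σ, τ ∈ cones
  /-- Two cones of the fan intersect in a common face. -/
  inter_eq : ∀ σ ∈ cones, ∀ τ ∈ cones,
    latticeCone gen σ ⊓ latticeCone gen τ = latticeCone gen (σ ∩ τ)
  /-- Smoothness: the ray generators of each cone are part of a `ℤ`-basis of the lattice. -/
  smooth : ∀ σ ∈ cones, ∃ (b : Module.Basis (Fin n) ℤ (Fin n → ℤ)) (e : ι → Fin n),
    Set.InjOn e σ ∧ ∀ ρ ∈ σ, b (e ρ) = gen ρ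
  /-- Completeness: the cones cover `ℝⁿ`. -/
  complete : ∀ v : Fin n → ℝ, ∃ σ ∈ cones, v ∈ latticeCone gen σ
  /-- Projectivity: there is an ample torus-invariant divisor `∑ a ρ • D_ρ`, that is, one whose
  support function is strictly convex. -/
  projective : ∃ a : ι → ℤ, ∀ σ, Maximal (· ∈ cones) σ → ∃ m : Fin n → ℤ,
    (∀ ρ ∈ σ, m ⬝ᵥ gen ρ = -a ρ) ∧ ∀ ρ ∉ σ, -a ρ < m ⬝ᵥ gen ρ

namespace SmoothProjectiveFan

variable {n : ℕ} {ι : Type*} [Fintype ι] [DecidableEq ι]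

/-- The map sending a character `m` to its divisor `∑ ⟨m, u_ρ⟩ D_ρ`. -/
def divMap (X : SmoothProjectiveFan n ι) : (Fin n → ℤ) →ₗ[ℤ] (ι → ℤ) :=
  (Matrix.of X.gen).mulVecLin

/-- `Pic X`: torus-invariant divisors modulo divisors of characters (this is the class group, which
is the Picard group because `X` is smooth). -/
abbrev Pic (X : SmoothProjectiveFan n ι) : Type _ := (ι → ℤ) ⧸ LinearMap.range X.divMap

noncomputable instance (X : SmoothProjectiveFan n ι) : DecidableEq X.Pic := Classical.decEq _

/-- The degree of the variable `x_ρ`: the class of the divisor `D_ρ`. -/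
def varDeg (X : SmoothProjectiveFan n ι) (ρ : ι) : X.Pic :=
  Submodule.Quotient.mk (Pi.single ρ 1)

/-- The Cox ring of `X` over `k`. -/
abbrev Cox (_X : SmoothProjectiveFan n ι) (k : Type*) [Field k] : Type _ := MvPolynomial ι k

variable (X : SmoothProjectiveFan n ι) (k : Type*) [Field k]

/-- The `Pic X`-grading of the Cox ring. -/
noncomputable def grading : X.Pic → Submodule k (X.Cox k) :=
  MvPolynomial.weightedHomogeneousSubmodule k X.varDeg

/-- The monomial `∏_{ρ ∉ σ} x_ρ`. -/
noncomputable def hat (σ : Finset ι) : X.Cox k := ∏ ρ ∈ σᶜ, MvPolynomial.X ρ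

/-- The degree of the monomial `X.hat k σ`. -/
def hatDeg (σ : Finset ι) : X.Pic := ∑ ρ ∈ σᶜ, X.varDeg ρ

/-- The irrelevant ideal of the Cox ring. -/
noncomputable def irrelevant : Ideal (X.Cox k) := Ideal.span (X.hat k '' (X.cones : Set (Finset ι)))

instance : SetLike.GradedMonoid (X.grading k) :=
  MvPolynomial.WeightedHomogeneousSubmodule.gradedMonoid

noncomputable instance : GradedAlgebra (X.grading k) :=
  MvPolynomial.weightedGradedAlgebra k X.varDeg

/-- The multiplicative set of powers of `X.hat k σ`. -/
noncomputable abbrev hatPowers (σ : Finset ι) : Submonoid (X.Cox k) := Submonoid.powers (X.hat k σ)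

/-- The element `(X.hat k σ) ^ t` of the multiplicative set. -/
noncomputable def hatPow (σ : Finset ι) (t : ℕ) : X.hatPowers k σ := ⟨X.hat k σ ^ t, t, rfl⟩

variable {k}

theorem hat_mem (σ : Finset ι) : X.hat k σ ∈ X.grading k (X.hatDeg σ) :=
  SetLike.prod_mem_graded (A := X.grading k) X.varDeg _
    fun ρ _ => MvPolynomial.isWeightedHomogeneous_X k X.varDeg ρ

theorem hat_pow_mem (σ : Finset ι) (t : ℕ) : X.hat k σ ^ t ∈ X.grading k (t • X.hatDeg σ) :=
  SetLike.pow_mem_graded t (X.hat_mem σ)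

theorem hatPow_mul (σ : Finset ι) (s t : ℕ) :
    X.hatPow k σ s * X.hatPow k σ t = X.hatPow k σ (s + t) :=
  Subtype.ext (pow_add _ _ _).symm

theorem hatPow_zero (σ : Finset ι) : X.hatPow k σ 0 = 1 := Subtype.ext (pow_zero _)

theorem hat_face {σ τ : Finset ι} (h : τ ⊆ σ) :
    X.hat k τ = X.hat k (τ ∪ σᶜ) * X.hat k σ := by
  unfold hat
  rw [← Finset.prod_union]
  · congr 1; ext ρ; have := @h ρ; simp; tauto
  · rw [Finset.disjoint_left]; intro ρ; simp

theorem hatDeg_face {σ τ : Finset ι} (h : τ ⊆ σ) :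
    X.hatDeg τ = X.hatDeg (τ ∪ σᶜ) + X.hatDeg σ := by
  unfold hatDeg
  rw [← Finset.sum_union]
  · congr 1; ext ρ; have := @h ρ; simp; tauto
  · rw [Finset.disjoint_left]; intro ρ; simp

variable (k)

/-- The coordinate ring of the affine chart `U_σ` of `X`: the degree zero part of the localization
of the Cox ring at `X.hat k σ`. -/
noncomputable def chartRing (σ : Finset ι) : Subalgebra k (Localization (X.hatPowers k σ)) where
  carrier := {z | ∃ (t : ℕ), ∃ s ∈ X.grading k (t • X.hatDeg σ),
    z = Localization.mk s (X.hatPow k σ t)}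
  mul_mem' := by
    rintro _ _ ⟨t, s, hs, rfl⟩ ⟨t', s', hs', rfl⟩
    refine ⟨t + t', s * s', ?_, ?_⟩
    · rw [add_smul]; exact SetLike.mul_mem_graded hs hs'
    · rw [Localization.mk_mul, hatPow_mul]
  add_mem' := by
    rintro _ _ ⟨t, s, hs, rfl⟩ ⟨t', s', hs', rfl⟩
    refine ⟨t + t', X.hat k σ ^ t * s' + X.hat k σ ^ t' * s, add_mem ?_ ?_, ?_⟩
    · rw [add_smul]; exact SetLike.mul_mem_graded (X.hat_pow_mem σ t) hs'
    · rw [add_comm t, add_smul]; exact SetLike.mul_mem_graded (X.hat_pow_mem σ t') hs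
    · rw [Localization.add_mk, hatPow_mul]; rfl
  algebraMap_mem' c := by
    refine ⟨0, algebraMap k _ c, ?_, ?_⟩
    · rw [zero_smul]; exact SetLike.algebraMap_mem_graded (X.grading k) c
    · rw [hatPow_zero, IsScalarTower.algebraMap_apply k (X.Cox k), Localization.mk_one_eq_algebraMap]

section GradedModules

variable {M : Type*} [AddCommGroup M] [Module (X.Cox k) M]
variable (ℳ : X.Pic → AddSubgroup M) [SetLike.GradedSMul (X.grading k) ℳ]
variable {N : Type*} [AddCommGroup N] [Module (X.Cox k) N]
variable (𝒩 : X.Pic → AddSubgroup N) [SetLike.GradedSMul (X.grading k) 𝒩]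

/-- The sections over the affine chart `U_σ` of the sheaf `M~` associated to a graded module `M`:
the degree zero part of the localization of `M` at `X.hat k σ`. -/
noncomputable def sections (σ : Finset ι) :
    Submodule (X.chartRing k σ) (LocalizedModule (X.hatPowers k σ) M) where
  carrier := {z | ∃ (t : ℕ), ∃ m ∈ ℳ (t • X.hatDeg σ), z = LocalizedModule.mk m (X.hatPow k σ t)}
  zero_mem' := ⟨0, 0, zero_mem _, (LocalizedModule.zero_mk _).symm⟩
  add_mem' := by
    rintro _ _ ⟨t, s, hs, rfl⟩ ⟨t', s', hs', rfl⟩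
    refine ⟨t + t', X.hat k σ ^ t' • s + X.hat k σ ^ t • s', add_mem ?_ ?_, ?_⟩
    · rw [add_comm t, add_smul]; exact SetLike.GradedSMul.smul_mem (X.hat_pow_mem σ t') hs
    · rw [add_smul]; exact SetLike.GradedSMul.smul_mem (X.hat_pow_mem σ t) hs'
    · rw [LocalizedModule.mk_add_mk, hatPow_mul]; rfl
  smul_mem' := by
    rintro ⟨_, t, s, hs, rfl⟩ _ ⟨t', m, hm, rfl⟩
    refine ⟨t + t', s • m, ?_, ?_⟩
    · rw [add_smul]; exact SetLike.GradedSMul.smul_mem hs hm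
    · rw [← hatPow_mul]; exact LocalizedModule.mk_smul_mk _ _ _ _

noncomputable instance (σ : Finset ι) : Module (X.chartRing k σ) (X.sections k ℳ σ) :=
  (X.sections k ℳ σ).module

variable {k} in
theorem isUnit_hatPowers {σ τ : Finset ι} (h : τ ⊆ σ) (x : X.hatPowers k σ) :
    IsUnit (algebraMap (X.Cox k)
      (Module.End (X.Cox k) (LocalizedModule (X.hatPowers k τ) M)) x) := by
  obtain ⟨_, t, rfl⟩ := x
  have hu := IsLocalizedModule.map_units
    (LocalizedModule.mkLinearMap (X.hatPowers k τ) M) (X.hatPow k τ t)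
  have he : ((X.hatPow k τ t : X.hatPowers k τ) : X.Cox k)
      = X.hat k (τ ∪ σᶜ) ^ t * X.hat k σ ^ t := by
    simp only [hatPow]; rw [X.hat_face h, mul_pow]
  rw [he, map_mul] at hu
  exact ((((Commute.all _ _).map (algebraMap (X.Cox k) _)).isUnit_mul_iff).mp hu).2

variable {k} in
/-- The localization map `M[1 / X.hat k σ] → M[1 / X.hat k τ]` for a face `τ` of `σ`. -/
noncomputable def locMap (M : Type*) [AddCommGroup M] [Module (X.Cox k) M]
    {σ τ : Finset ι} (h : τ ⊆ σ) :
    LocalizedModule (X.hatPowers k σ) M →ₗ[X.Cox k] LocalizedModule (X.hatPowers k τ) M :=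
  LocalizedModule.lift _ (LocalizedModule.mkLinearMap _ M) (X.isUnit_hatPowers h)

variable {k} in
theorem locMap_mk {σ τ : Finset ι} (h : τ ⊆ σ) (m : M) (t : ℕ) :
    X.locMap M h (LocalizedModule.mk m (X.hatPow k σ t)) =
      LocalizedModule.mk (X.hat k (τ ∪ σᶜ) ^ t • m) (X.hatPow k τ t) := by
  unfold locMap
  rw [LocalizedModule.lift_mk, Module.End.algebraMap_isUnit_inv_apply_eq_iff,
    LocalizedModule.mkLinearMap_apply, LocalizedModule.smul'_mk, smul_smul]
  have he : ((X.hatPow k σ t : X.hatPowers k σ) : X.Cox k) * X.hat k (τ ∪ σᶜ) ^ t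
      = (X.hatPow k τ t : X.hatPowers k τ) := by
    simp only [hatPow]; rw [X.hat_face h, mul_pow, mul_comm]
  rw [he]
  exact (LocalizedModule.mk_cancel _ _).symm

/-- The restriction map `M~(U_σ) → M~(U_τ)` for a face `τ` of `σ`. -/
noncomputable def restrict {σ τ : Finset ι} (h : τ ⊆ σ) :
    X.sections k ℳ σ →+ X.sections k ℳ τ where
  toFun z := ⟨X.locMap M h z, by
    obtain ⟨_, t, m, hm, rfl⟩ := z
    refine ⟨t, _, ?_, X.locMap_mk h m t⟩
    rw [X.hatDeg_face h, smul_add]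
    exact SetLike.GradedSMul.smul_mem (X.hat_pow_mem _ t) hm⟩
  map_zero' := Subtype.ext (map_zero (X.locMap M h))
  map_add' a b := Subtype.ext (map_add (X.locMap M h) a.1 b.1)

/-- A morphism `M~ → N~` of quasi-coherent sheaves on `X`: linear maps on the affine charts `U_σ`
that are compatible with restriction to the charts of the faces
(recall that `U_σ ∩ U_σ' = U_{σ ∩ σ'}`). -/
structure SheafHom where
  app : ∀ σ ∈ X.cones, X.sections k ℳ σ →ₗ[X.chartRing k σ] X.sections k 𝒩 σ
  app_restrict : ∀ σ (hσ : σ ∈ X.cones) τ (h : τ ⊆ σ) (z : X.sections k ℳ σ),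
    app τ (X.face_mem σ hσ τ h) (X.restrict k ℳ h z) = X.restrict k 𝒩 h (app σ hσ z)

/-- `M~` and `N~` are isomorphic as sheaves on `X`. -/
def SheafIso : Prop :=
  ∃ φ : X.SheafHom k ℳ 𝒩, ∀ σ (hσ : σ ∈ X.cones), Function.Bijective (φ.app σ hσ)

/-- The sheaf `M~` is nonzero. -/
def SheafNonzero : Prop := ∃ σ ∈ X.cones, Nontrivial (X.sections k ℳ σ)

variable {k ℳ 𝒩}

/-- The map `M~(U_σ) → N~(U_σ)` induced by a homomorphism of graded modules of degree zero. -/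
noncomputable def sectionsMap (f : M →ₗ[X.Cox k] N) (hf : ∀ d, ∀ m ∈ ℳ d, f m ∈ 𝒩 d)
    (σ : Finset ι) : X.sections k ℳ σ →ₗ[X.chartRing k σ] X.sections k 𝒩 σ where
  toFun z := ⟨LocalizedModule.map (X.hatPowers k σ) f z, by
    obtain ⟨_, t, m, hm, rfl⟩ := z
    exact ⟨t, f m, hf _ m hm, LocalizedModule.map_mk (X.hatPowers k σ) f m _⟩⟩
  map_add' a b := Subtype.ext (map_add _ _ _)
  map_smul' r a := Subtype.ext (map_smul (LocalizedModule.map (X.hatPowers k σ) f) r.1 a.1)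

end GradedModules

/-- The grading of the free module `⊕ⱼ S(-aⱼ)`. -/
noncomputable def freeGrading {r : ℕ} (a : Fin r → X.Pic) (d : X.Pic) : AddSubgroup (Fin r → X.Cox k) where
  carrier := {f | ∀ j, f j ∈ X.grading k (d - a j)}
  zero_mem' _ := zero_mem _
  add_mem' hf hg j := add_mem (hf j) (hg j)
  neg_mem' hf j := neg_mem (hf j)

instance {r : ℕ} (a : Fin r → X.Pic) :
    SetLike.GradedSMul (X.grading k) (X.freeGrading k a) where
  smul_mem {i j s f} hs hf l := by
    have h : (i +ᵥ j : X.Pic) - a l = i + (j - a l) := by rw [vadd_eq_add]; abel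
    rw [h]
    exact SetLike.mul_mem_graded hs (hf l)

/-- A complex `F₀ ← F₁ ← ⋯` of finitely generated free graded modules over the Cox ring, with
differentials of degree zero; `Fᵢ = ⊕ⱼ S(-twist i j)`. -/
structure FreeComplex where
  rank : ℕ → ℕ
  twist : ∀ i, Fin (rank i) → X.Pic
  d : ∀ i, (Fin (rank (i + 1)) → X.Cox k) →ₗ[X.Cox k] (Fin (rank i) → X.Cox k)
  d_mem : ∀ i e, ∀ f ∈ X.freeGrading k (twist (i + 1)) e, d i f ∈ X.freeGrading k (twist i) e
  d_comp_d : ∀ i, d i ∘ₗ d (i + 1) = 0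

/-- The length of a free complex: the supremum of the `i` with `Fᵢ ≠ 0`. -/
noncomputable def FreeComplex.length {X : SmoothProjectiveFan n ι} {k : Type*} [Field k]
    (F : X.FreeComplex k) : ℕ∞ :=
  ⨆ (i : ℕ) (_ : F.rank i ≠ 0), (i : ℕ∞)

/-- The map `Fᵢ₊₁~(U_σ) → Fᵢ~(U_σ)` induced by the differential. -/
noncomputable def FreeComplex.dSections {X : SmoothProjectiveFan n ι} {k : Type*} [Field k]
    (F : X.FreeComplex k) (i : ℕ) (σ : Finset ι) :
    X.sections k (X.freeGrading k (F.twist (i + 1))) σ →ₗ[X.chartRing k σ]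
      X.sections k (X.freeGrading k (F.twist i)) σ :=
  X.sectionsMap (F.d i) (F.d_mem i) σ

section VirtuallyCM

variable {M : Type*} [AddCommGroup M] [Module (X.Cox k) M]
variable (ℳ : X.Pic → AddSubgroup M) [SetLike.GradedSMul (X.grading k) ℳ]

/-- `F` is a virtual resolution of `M`: there is a morphism of sheaves `F₀~ → M~` making
`0 ← M~ ← F₀~ ← F₁~ ← ⋯` an exact complex of sheaves (exactness is tested on the affine charts). -/
def IsVirtualResolution (F : X.FreeComplex k) : Prop :=
  ∃ ε : X.SheafHom k (X.freeGrading k (F.twist 0)) ℳ, ∀ σ (hσ : σ ∈ X.cones),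
    Function.Surjective (ε.app σ hσ) ∧
    Function.Exact (F.dSections 0 σ) (ε.app σ hσ) ∧
    ∀ i, Function.Exact (F.dSections (i + 1) σ) (F.dSections i σ)

/-- The virtual dimension of `M`: the minimal length of a virtual resolution. -/
noncomputable def vdim : ℕ∞ := ⨅ (F : X.FreeComplex k) (_ : X.IsVirtualResolution k ℳ F), F.length

/-- `M` is virtually Cohen--Macaulay: `M~ ≠ 0` and `vdim M = codim M`, where `codim M` is the
codimension of `Spec (S / Ann M)` in `Spec S`. -/
def IsVirtuallyCM : Prop :=
  X.SheafNonzero k ℳ ∧ X.vdim k ℳ = (Module.annihilator (X.Cox k) M).height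

/-- An ideal is relevant if it contains no power of the irrelevant ideal. -/
def IsRelevant (I : Ideal (X.Cox k)) : Prop := ∀ t : ℕ, 1 ≤ t → ¬ X.irrelevant k ^ t ≤ I

/-- `M` is `B`-saturated: the submodule `H⁰_B(M)` of elements killed by a power of the irrelevant
ideal `B` is zero. -/
def IsSaturated (M : Type*) [AddCommGroup M] [Module (X.Cox k) M] : Prop :=
  ∀ m : M, (∃ t : ℕ, ∀ b ∈ X.irrelevant k ^ t, b • m = 0) → m = 0

/-- The saturation `(I : B^∞)` of an ideal with respect to the irrelevant ideal `B`. -/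
noncomputable def saturation (I : Ideal (X.Cox k)) : Ideal (X.Cox k) :=
  ⨆ t : ℕ, Submodule.colon I (X.irrelevant k ^ t : Ideal (X.Cox k))

end VirtuallyCM

/-- An ideal `I` of a ring `S` is unmixed if `dim S/P = dim S/I` for all its associated primes. -/
def UnmixedIdeal {S : Type*} [CommRing S] (I : Ideal S) : Prop :=
  ∀ P ∈ associatedPrimes S (S ⧸ I), ringKrullDim (S ⧸ P) = ringKrullDim (S ⧸ I)

/-- `M` is virtually unmixed: all four conditions below hold. In the second and the fourth one, `N`
is any `B`-saturated graded module with `N~ ≅ M~` (finitely generated or not). -/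
structure IsVirtuallyUnmixed {M : Type v} [AddCommGroup M] [Module (X.Cox k) M]
    (ℳ : X.Pic → AddSubgroup M) [SetLike.GradedSMul (X.grading k) ℳ] : Prop where
  relevant : ∀ P ∈ associatedPrimes (X.Cox k) M, X.IsRelevant k P →
    ringKrullDim (X.Cox k ⧸ P) = Module.supportDim (X.Cox k) M
  saturated : ∀ (N : Type v) [AddCommGroup N] [Module (X.Cox k) N] (𝒩 : X.Pic → AddSubgroup N)
    [DirectSum.Decomposition 𝒩] [SetLike.GradedSMul (X.grading k) 𝒩],
    X.IsSaturated k N → X.SheafIso k 𝒩 ℳ → ∀ P ∈ associatedPrimes (X.Cox k) N,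
      ringKrullDim (X.Cox k ⧸ P) = Module.supportDim (X.Cox k) N
  annihilator : UnmixedIdeal (X.saturation k (Module.annihilator (X.Cox k) M))
  saturated_annihilator : ∀ (N : Type v) [AddCommGroup N] [Module (X.Cox k) N]
    (𝒩 : X.Pic → AddSubgroup N) [DirectSum.Decomposition 𝒩]
    [SetLike.GradedSMul (X.grading k) 𝒩],
    X.IsSaturated k N → X.SheafIso k 𝒩 ℳ → UnmixedIdeal (Module.annihilator (X.Cox k) N)

end SmoothProjectiveFan

/-!
Over a cone `σ`, the variables `x_ρ` with `ρ ∉ σ` become invertible in `S_σ = S[1 / X.hat k σ]`,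
and since `X` is smooth along `σ` their degrees generate `Pic X`. So `S_σ` has homogeneous units of
every degree: it is free over the coordinate ring of the chart `U_σ`, and `M_σ = S_σ ⊗ M~(U_σ)` for
every graded module `M`. Hence a virtual resolution of `M` becomes, over `S_σ`, a flat resolution
of `M_σ`.

If `P` is an associated prime of `M_σ` of height `h`, then localizing such a resolution at `P` and
dividing by a regular sequence of length `h` in the regular local ring `S_P` shows that its `h`-th
term is nonzero, so `ht P ≤ vdim M = codim M`. As `ht P + dim S / P = dim S` for every prime of a
polynomial ring, `S / P` then has the dimension of `M`. Finally, saturated modules, and the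
saturations of annihilators, only see the localizations `M_σ`.
-/

section RegularLocalRing

open IsLocalRing RingTheory.Sequence

section

variable {R : Type*} [CommRing R] [IsLocalRing R]

theorem exists_mem_maximalIdeal_notMem_sq_notMem_minimalPrimes [IsNoetherianRing R]
    (h : (maximalIdeal R).height ≠ 0) :
    ∃ x ∈ maximalIdeal R, x ∉ maximalIdeal R ^ 2 ∧ ∀ q ∈ minimalPrimes R, x ∉ q := by
  by_contra! hcon
  have hcover : (maximalIdeal R : Set R) ⊆
      ⋃ q ∈ insert (maximalIdeal R ^ 2) (minimalPrimes R), (q : Set R) := fun x hx => by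
    simp only [Set.mem_insert_iff, Set.iUnion_iUnion_eq_or_left, Set.mem_union, Set.mem_iUnion]
    by_cases h2 : x ∈ maximalIdeal R ^ 2
    · exact Or.inl h2
    · obtain ⟨q, hq, hxq⟩ := hcon x hx h2
      exact Or.inr ⟨q, hq, hxq⟩
  obtain ⟨q, hq, hle⟩ := (Ideal.subset_union_prime_finite (f := id)
    ((minimalPrimes.finite_of_isNoetherianRing R).insert _) (maximalIdeal R ^ 2)
    (maximalIdeal R ^ 2) fun q hq hne _ =>
      ((Set.mem_insert_iff.1 hq).resolve_left hne).1.1).1 hcover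
  rcases hq with rfl | hq
  · have hbot : maximalIdeal R = ⊥ := Submodule.eq_bot_of_le_smul_of_le_jacobson_bot
      (maximalIdeal R) _ (IsNoetherian.noetherian _) (by simpa [pow_two] using hle)
      (maximalIdeal_le_jacobson _)
    exact h (by rw [hbot, Ideal.height_bot])
  · have := hq.1.1
    have hqm : q = maximalIdeal R := le_antisymm (le_maximalIdeal this.ne_top) hle
    exact h (hqm ▸ Ideal.height_eq_zero_iff.2 hq)

theorem exists_maximalIdeal_eq_span_singleton_sup_span_range {n : ℕ} {v : Fin (n + 1) → R}
    (hv : maximalIdeal R = Ideal.span (Set.range v)) {x : R} (hx : x ∈ maximalIdeal R)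
    (hx2 : x ∉ maximalIdeal R ^ 2) :
    ∃ w : Fin n → R, maximalIdeal R = Ideal.span {x} ⊔ Ideal.span (Set.range w) := by
  have hvm (j) : v j ∈ maximalIdeal R := hv ▸ Ideal.subset_span ⟨j, rfl⟩
  obtain ⟨a, rfl⟩ := Ideal.mem_span_range_iff_exists_fun.1 (hv ▸ hx)
  obtain ⟨i, hi⟩ : ∃ i, IsUnit (a i) := by
    by_contra! hcon
    exact hx2 (Ideal.sum_mem _ fun i _ => pow_two (maximalIdeal R) ▸
      Ideal.mul_mem_mul (hcon i) (hvm i))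
  refine ⟨v ∘ i.succAbove, le_antisymm ?_ (sup_le ?_ ?_)⟩
  · rw [hv, Ideal.span_le]
    rintro _ ⟨j, rfl⟩
    have hw (l) : v (i.succAbove l) ∈ Ideal.span (Set.range (v ∘ i.succAbove)) :=
      Ideal.subset_span ⟨l, rfl⟩
    rcases Fin.eq_self_or_eq_succAbove i j with rfl | ⟨l, rfl⟩
    · refine (Ideal.unit_mul_mem_iff_mem _ hi).1 ?_
      rw [← add_sub_cancel_right (a j * v j) (∑ l, a (j.succAbove l) * v (j.succAbove l)),
        ← Fin.sum_univ_succAbove (fun l => a l * v l)]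
      exact sub_mem (Ideal.mem_sup_left (Ideal.mem_span_singleton_self _))
        (Ideal.mem_sup_right (sum_mem fun l _ => Ideal.mul_mem_left _ _ (hw l)))
    · exact Ideal.mem_sup_right (hw l)
  · exact (Ideal.span_singleton_le_iff_mem _).2 hx
  · rw [Ideal.span_le]
    rintro _ ⟨l, rfl⟩
    exact hvm _

theorem spanFinrank_maximalIdeal_quotient_span_singleton_lt [IsNoetherianRing R] {x : R}
    (hx : x ∈ maximalIdeal R) (hx2 : x ∉ maximalIdeal R ^ 2)
    [IsLocalRing (R ⧸ Ideal.span {x})] :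
    (maximalIdeal (R ⧸ Ideal.span {x})).spanFinrank < (maximalIdeal R).spanFinrank := by
  obtain ⟨s, hs, hspan⟩ := Submodule.FG.exists_span_finset_card_eq_spanFinrank
    (IsNoetherian.noetherian (maximalIdeal R))
  obtain ⟨n, hn⟩ : ∃ n, s.card = n + 1 := Nat.exists_eq_succ_of_ne_zero fun h => hx2 <| by
    rw [Finset.card_eq_zero.1 h, Finset.coe_empty, Submodule.span_empty] at hspan
    have hx0 : x = 0 := (Submodule.mem_bot R).1 (hspan ▸ hx)
    exact hx0 ▸ zero_mem _
  obtain ⟨w, hw⟩ := exists_maximalIdeal_eq_span_singleton_sup_span_range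
    (v := fun i => ((s.equivFinOfCardEq hn).symm i : R)) (by
      rw [← hspan, Set.range_comp' Subtype.val, (s.equivFinOfCardEq hn).symm.range_eq_univ]
      simp [Ideal.span]) hx hx2
  have hmax : maximalIdeal (R ⧸ Ideal.span {x}) =
      Ideal.span (Set.range (Ideal.Quotient.mk (Ideal.span {x}) ∘ w)) := by
    rw [← map_maximalIdeal_of_surjective _ Ideal.Quotient.mk_surjective, hw, Ideal.map_sup,
      Ideal.map_quotient_self, bot_sup_eq, Ideal.map_span, Set.range_comp]
  rw [hmax, ← hs, hn, Nat.lt_succ_iff]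
  refine (Submodule.spanFinrank_span_le_ncard_of_finite (Set.finite_range _)).trans ?_
  rw [← Set.image_univ]
  exact (Set.ncard_image_le Set.finite_univ).trans (by simp)

end

variable {R : Type*} [CommRing R] [IsRegularLocalRing R]

theorem exists_isRegularLocalRing_quotient_span_singleton {n : ℕ}
    (hn : ringKrullDim R = (n + 1 : ℕ)) :
    ∃ x ∈ maximalIdeal R, (∀ q ∈ minimalPrimes R, x ∉ q) ∧
      IsRegularLocalRing (R ⧸ Ideal.span {x}) ∧ ringKrullDim (R ⧸ Ideal.span {x}) = n := by
  obtain ⟨x, hxm, hx2, hxq⟩ := exists_mem_maximalIdeal_notMem_sq_notMem_minimalPrimes (R := R) (by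
    intro h0
    rw [← maximalIdeal_height_eq_ringKrullDim, h0] at hn
    norm_cast at hn)
  have hle : Ideal.span {x} ≤ maximalIdeal R := (Ideal.span_singleton_le_iff_mem _).2 hxm
  have : Nontrivial (R ⧸ Ideal.span {x}) := Ideal.Quotient.nontrivial_iff.2
    fun h => (maximalIdeal.isMaximal R).ne_top (top_le_iff.1 (h ▸ hle))
  have : IsLocalRing (R ⧸ Ideal.span {x}) :=
    IsLocalRing.of_surjective' (Ideal.Quotient.mk _) Ideal.Quotient.mk_surjective
  have hspan : (maximalIdeal (R ⧸ Ideal.span {x})).spanFinrank ≤ n := by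
    have hR := ((isRegularLocalRing_iff R).1 ‹_›).trans hn
    have := spanFinrank_maximalIdeal_quotient_span_singleton_lt hxm hx2
    norm_cast at hR
    lia
  have hdim : (n : WithBot ℕ∞) ≤ ringKrullDim (R ⧸ Ideal.span {x}) := by
    have := Ideal.height_le_ringKrullDim_quotient_add_one hxm
    rw [maximalIdeal_height_eq_ringKrullDim, hn, Nat.cast_add_one] at this
    exact ENat.WithBot.add_le_add_one_right_iff.1 this
  have hreg : IsRegularLocalRing (R ⧸ Ideal.span {x}) :=
    .of_spanFinrank_maximalIdeal_le _ ((Nat.cast_le.2 hspan).trans hdim)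
  refine ⟨x, hxm, hxq, hreg, hdim.antisymm' ?_⟩
  rw [← (isRegularLocalRing_iff _).1 hreg]
  exact_mod_cast hspan

theorem isDomain_of_isPrime_span_singleton {R : Type*} [CommRing R] [IsLocalRing R]
    [IsNoetherianRing R] {x : R} (hxm : x ∈ maximalIdeal R) (hxq : ∀ q ∈ minimalPrimes R, x ∉ q)
    (hx : (Ideal.span {x}).IsPrime) : IsDomain R := by
  obtain ⟨q, hq, hqx⟩ := Ideal.exists_minimalPrimes_le (I := ⊥) (J := Ideal.span {x}) bot_le
  have hqp : q.IsPrime := hq.1.1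
  have hmul : q ≤ maximalIdeal R * q := fun y hy => by
    obtain ⟨z, rfl⟩ := Ideal.mem_span_singleton'.1 (hqx hy)
    exact mul_comm x z ▸ Ideal.mul_mem_mul hxm ((hqp.mem_or_mem hy).resolve_right (hxq q hq))
  have hbot : q = ⊥ := Submodule.eq_bot_of_le_smul_of_le_jacobson_bot (maximalIdeal R) _
    (IsNoetherian.noetherian _) hmul (maximalIdeal_le_jacobson _)
  rw [hbot] at hqp
  exact IsDomain.of_bot_isPrime R

theorem isDomain_of_isRegularLocalRing (R : Type*) [CommRing R] [IsRegularLocalRing R] :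
    IsDomain R := by
  obtain ⟨n, hn⟩ : ∃ n : ℕ, ringKrullDim R = n := ⟨_, ((isRegularLocalRing_iff R).1 ‹_›).symm⟩
  induction n generalizing R with
  | zero =>
    have hreg := ((isRegularLocalRing_iff R).1 ‹_›).trans hn
    have hbot : maximalIdeal R = ⊥ :=
      (Submodule.spanFinrank_eq_zero_iff_eq_bot (IsNoetherian.noetherian _)).1
        (by exact_mod_cast hreg)
    exact (isField_iff_maximalIdeal_eq.2 hbot).isDomain
  | succ n ih =>
    obtain ⟨x, hxm, hxq, _, hdim⟩ := exists_isRegularLocalRing_quotient_span_singleton hn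
    exact isDomain_of_isPrime_span_singleton hxm hxq
      ((Ideal.Quotient.isDomain_iff_prime _).1 (ih _ hdim))

theorem isWeaklyRegular_cons_of_map_quotient {R : Type*} [CommRing R] {x : R}
    (hx : IsSMulRegular R x) {rs : List R}
    (h : IsWeaklyRegular (R ⧸ Ideal.span {x}) (rs.map (Ideal.Quotient.mk (Ideal.span {x})))) :
    IsWeaklyRegular R (x :: rs) := by
  refine (isWeaklyRegular_cons_iff _ _ _).2 ⟨hx, ?_⟩
  refine (LinearEquiv.isWeaklyRegular_congr (Submodule.quotEquivOfEq _ _ ?_) rs).2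
    ((isWeaklyRegular_map_algebraMap_iff (R ⧸ Ideal.span {x}) _ rs).1 h)
  rw [← Submodule.ideal_span_singleton_smul, smul_eq_mul, Ideal.mul_top]

theorem exists_isWeaklyRegular_of_ringKrullDim_eq (R : Type*) [CommRing R] [IsRegularLocalRing R]
    {n : ℕ} (hn : ringKrullDim R = n) :
    ∃ rs : List R, rs.length = n ∧ (∀ r ∈ rs, r ∈ maximalIdeal R) ∧ IsWeaklyRegular R rs := by
  induction n generalizing R with
  | zero => exact ⟨[], rfl, by simp, IsWeaklyRegular.nil _ _⟩
  | succ n ih =>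
    obtain ⟨x, hxm, hxq, _, hdim⟩ := exists_isRegularLocalRing_quotient_span_singleton hn
    obtain ⟨rs, hlen, hmem, hreg⟩ := ih _ hdim
    obtain ⟨rs, rfl⟩ := List.map_surjective_iff.2 Ideal.Quotient.mk_surjective rs
    have := isDomain_of_isRegularLocalRing R
    have hx0 : x ≠ 0 := by
      rintro rfl
      exact hxq ⊥ (by simp [IsDomain.minimalPrimes_eq_singleton_bot]) (zero_mem _)
    refine ⟨x :: rs, by simpa using hlen, ?_,
      isWeaklyRegular_cons_of_map_quotient (fun a b h => mul_left_cancel₀ hx0 h) hreg⟩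
    refine List.forall_mem_cons.2 ⟨hxm, fun r hr => ?_⟩
    exact fun hunit => hmem _ (List.mem_map_of_mem hr) (hunit.map _)

end RegularLocalRing

section Dimension

theorem coheight_eq_ringKrullDim_quotient {R : Type*} [CommRing R] (P : PrimeSpectrum R) :
    (Order.coheight P : WithBot ℕ∞) = ringKrullDim (R ⧸ P.asIdeal) := by
  rw [Order.coheight_eq_krullDim_Ici, ringKrullDim_quotient]
  rfl

theorem exists_isMaximal_forall_le_of_mem_minimalPrimes {R : Type*} [CommRing R]
    [IsNoetherianRing R] [IsJacobsonRing R] {I P : Ideal R} (hP : P ∈ I.minimalPrimes) :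
    ∃ m : Ideal R, m.IsMaximal ∧ P ≤ m ∧ ∀ Q : Ideal R, Q.IsPrime → I ≤ Q → Q ≤ m → P ≤ Q := by
  have hPp : P.IsPrime := hP.1.1
  have hfin := I.finite_minimalPrimes_of_isNoetherianRing
  obtain ⟨g, hg, hgP⟩ : ∃ g ∈ (hfin.toFinset.erase P).inf id, g ∉ P := by
    refine SetLike.not_le_iff_exists.1 fun h => ?_
    obtain ⟨Q, hQ, hQP⟩ := (Ideal.IsPrime.inf_le' hPp).1 h
    simp only [Finset.mem_erase, Set.Finite.mem_toFinset] at hQ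
    exact hQ.1 (le_antisymm hQP (hP.2 hQ.2.1 hQP))
  obtain ⟨m, ⟨hPm, hm⟩, hgm⟩ : ∃ m ∈ {J : Ideal R | P ≤ J ∧ J.IsMaximal}, g ∉ m := by
    by_contra! hcon
    have hrad : sInf {J : Ideal R | P ≤ J ∧ J.IsMaximal} = P :=
      IsJacobsonRing.out' P hPp.isRadical
    exact hgP (hrad ▸ Submodule.mem_sInf.2 hcon)
  refine ⟨m, hm, hPm, fun Q hQ hIQ hQm => ?_⟩
  obtain ⟨q, hq, hqQ⟩ := Ideal.exists_minimalPrimes_le hIQ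
  obtain rfl | hne := eq_or_ne q P
  · exact hqQ
  · have hle : (hfin.toFinset.erase P).inf id ≤ q := Finset.inf_le (f := id) (by simp [hne, hq])
    exact absurd (hQm (hqQ (hle hg))) hgm

theorem height_map_quotientMk_le_coheight {R : Type*} [CommRing R] {I m : Ideal R} [m.IsPrime]
    (hIm : I ≤ m) (P : PrimeSpectrum R)
    (hP : ∀ Q : Ideal R, Q.IsPrime → I ≤ Q → Q ≤ m → P.asIdeal ≤ Q) :
    (m.map (Ideal.Quotient.mk I)).height ≤ Order.coheight P := by
  have hm' : (m.map (Ideal.Quotient.mk I)).IsPrime := Ideal.isPrime_map_quotientMk_of_isPrime hIm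
  have hle (Q : Set.Iic (⟨_, hm'⟩ : PrimeSpectrum (R ⧸ I))) :
      P ≤ PrimeSpectrum.comap (Ideal.Quotient.mk I) Q.1 := by
    refine hP _ inferInstance (Ideal.mk_ker.ge.trans (Ideal.comap_mono bot_le)) ?_
    refine (Ideal.comap_mono Q.2).trans ?_
    rw [Ideal.comap_map_of_surjective' _ Ideal.Quotient.mk_surjective, Ideal.mk_ker,
      sup_eq_left.2 hIm]
  rw [← WithBot.coe_le_coe, Order.coheight_eq_krullDim_Ici,
    PrimeSpectrum.height_eq_orderHeight ⟨_, hm'⟩, Order.height_eq_krullDim_Iic]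
  exact Order.krullDim_le_of_strictMono (fun Q => ⟨_, hle Q⟩) fun _ _ h =>
    RingHom.strictMono_comap_of_surjective Ideal.Quotient.mk_surjective h

variable {ι k : Type*} [Finite ι] [Field k]

theorem height_eq_natCard_of_isMaximal (m : Ideal (MvPolynomial ι k)) [hm : m.IsMaximal] :
    m.height = Nat.card ι := by
  refine le_antisymm ?_ ?_
  · have := Ideal.height_le_ringKrullDim_of_ne_top hm.ne_top
    rw [MvPolynomial.ringKrullDim_of_isNoetherianRing, ringKrullDim_eq_zero_of_field,
      zero_add] at this
    exact_mod_cast this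
  · induction ι using Finite.induction_empty_option with
    | of_equiv e ih =>
      let e' := (MvPolynomial.renameEquiv k e).toRingEquiv
      have := ih (m.comap e') (hm := Ideal.comap_isMaximal_of_equiv e')
      rwa [RingEquiv.height_comap, Nat.card_congr e] at this
    | h_empty => simp
    | @h_option ι _ ih =>
      let e := (MvPolynomial.optionEquivLeft k ι).toRingEquiv.symm
      have hm' : (m.comap e).IsMaximal := Ideal.comap_isMaximal_of_equiv e
      have hn : ((m.comap e).comap Polynomial.C).IsMaximal :=
        Polynomial.isMaximal_comap_C_of_isJacobsonRing _
      have : (m.comap e).LiesOver ((m.comap e).comap Polynomial.C) := ⟨rfl⟩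
      have hheight := Polynomial.height_eq_height_add_one
        ((m.comap e).comap Polynomial.C) (m.comap e)
      rw [RingEquiv.height_comap] at hheight
      rw [hheight, Finite.card_option, Nat.cast_add, Nat.cast_one]
      gcongr
      exact ih _

theorem height_add_coheight_eq_natCard (P : PrimeSpectrum (MvPolynomial ι k)) :
    P.asIdeal.height + Order.coheight P = Nat.card ι := by
  refine le_antisymm ?_ ?_
  · have hdim : ringKrullDim (MvPolynomial ι k) = (Nat.card ι : ℕ∞) := by
      rw [MvPolynomial.ringKrullDim_of_isNoetherianRing, ringKrullDim_eq_zero_of_field, zero_add]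
      rfl
    rw [ringKrullDim, Order.krullDim_eq_iSup_height_add_coheight_of_nonempty] at hdim
    rw [PrimeSpectrum.height_eq_orderHeight, ← WithBot.coe_inj.1 hdim]
    exact le_iSup (fun Q => Order.height Q + Order.coheight Q) P
  · obtain ⟨s, hs, hcard⟩ := P.asIdeal.exists_finset_card_eq_height_of_isNoetherianRing
    obtain ⟨m, hm, hPm, hmin⟩ := exists_isMaximal_forall_le_of_mem_minimalPrimes hs
    have hsm : Ideal.span s ≤ m := hs.1.2.trans hPm
    have hle := Ideal.height_le_height_add_encard_of_subset (s : Set (MvPolynomial ι k)) (p := m)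
      (Ideal.span_le.1 hsm)
    rw [height_eq_natCard_of_isMaximal, Set.encard_coe_eq_coe_finsetCard, hcard, add_comm] at hle
    exact hle.trans (by gcongr; exact height_map_quotientMk_le_coheight hsm P hmin)

theorem ringKrullDim_quotient_eq_krullDim_of_forall_height_le
    {Z : Set (PrimeSpectrum (MvPolynomial ι k))} (hZ : IsUpperSet Z)
    {P : PrimeSpectrum (MvPolynomial ι k)} (hP : P ∈ Z)
    (hmin : ∀ Q ∈ Z, P.asIdeal.height ≤ Q.asIdeal.height) :
    ringKrullDim (MvPolynomial ι k ⧸ P.asIdeal) = Order.krullDim Z := by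
  rw [← coheight_eq_ringKrullDim_quotient]
  refine le_antisymm ?_ ?_
  · rw [Order.coheight_eq_krullDim_Ici]
    exact Order.krullDim_le_of_strictMono (fun Q => ⟨Q.1, hZ Q.2 hP⟩) fun _ _ h => h
  · rw [Order.krullDim_eq_iSup_coheight]
    refine iSup_le fun Q => WithBot.coe_le_coe.2 ?_
    refine (Order.coheight_le_coheight_apply_of_strictMono Subtype.val (fun _ _ h => h) Q).trans ?_
    have hfin : Q.1.asIdeal.height ≠ ⊤ := Ideal.height_ne_top_of_isPrime
    refine (ENat.add_le_add_iff_left hfin).1 ?_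
    rw [height_add_coheight_eq_natCard, ← height_add_coheight_eq_natCard P]
    exact add_le_add_left (hmin Q Q.2) _

theorem mem_support_of_isAssociatedPrime {R M : Type*} [CommRing R] [AddCommGroup M] [Module R M]
    {P : Ideal R} (hP : IsAssociatedPrime P M) : ⟨P, hP.isPrime⟩ ∈ Module.support R M := by
  obtain ⟨x, hx⟩ := hP.2
  refine Module.mem_support_iff_exists_annihilator.2 ⟨x, fun a ha => hx.ge (Ideal.le_radical ?_)⟩
  rw [Submodule.mem_colon_singleton, Submodule.mem_bot]
  exact (Submodule.mem_annihilator_span_singleton _ _).1 ha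

theorem ringKrullDim_quotient_eq_supportDim_of_height_le {N : Type*} [AddCommGroup N]
    [Module (MvPolynomial ι k) N] {P : Ideal (MvPolynomial ι k)} (hP : IsAssociatedPrime P N)
    (hle : P.height ≤ (Module.annihilator (MvPolynomial ι k) N).height) :
    ringKrullDim (MvPolynomial ι k ⧸ P) = Module.supportDim (MvPolynomial ι k) N :=
  ringKrullDim_quotient_eq_krullDim_of_forall_height_le (P := ⟨P, hP.isPrime⟩)
    (fun _ _ hQ hQm => Module.mem_support_mono hQ hQm) (mem_support_of_isAssociatedPrime hP)
    fun _ hQ => hle.trans (Ideal.height_mono (Module.annihilator_le_of_mem_support hQ))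

theorem unmixedIdeal_of_forall_height_le {I : Ideal (MvPolynomial ι k)}
    (h : ∀ P ∈ associatedPrimes (MvPolynomial ι k) (MvPolynomial ι k ⧸ I), P.height ≤ I.height) :
    SmoothProjectiveFan.UnmixedIdeal I := by
  intro P hP
  rw [← Module.supportDim_quotient_eq_ringKrullDim I]
  exact ringKrullDim_quotient_eq_supportDim_of_height_le hP
    (by rw [Ideal.annihilator_quotient]; exact h P hP)

end Dimension

section FlatResolution

open IsLocalRing RingTheory.Sequence

variable {R : Type*} [CommRing R]

theorem isWeaklyRegular_of_flat {M : Type*} [AddCommGroup M] [Module R M] [Module.Flat R M]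
    {rs : List R} (h : IsWeaklyRegular R rs) : IsWeaklyRegular M rs :=
  (LinearEquiv.isWeaklyRegular_congr (TensorProduct.rid R M) rs).1
    (IsWeaklyRegular.isWeaklyRegular_lTensor (M₂ := M) h)

open Pointwise in
theorem quotSMulTop_mk_eq_mk_iff {M : Type*} [AddCommGroup M] [Module R M] {x : R} {a b : M} :
    (Submodule.Quotient.mk a : QuotSMulTop x M) = Submodule.Quotient.mk b ↔
      ∃ u, x • u = a - b := by
  simp [Submodule.Quotient.eq, Submodule.mem_smul_pointwise_iff_exists]

variable {F : ℕ → Type*} [∀ i, AddCommGroup (F i)] [∀ i, Module R (F i)]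
  {d : ∀ i, F (i + 1) →ₗ[R] F i}

-- Induct on `rs`: if `x • f = d g`, then the class of `g` in `F₁ / x F₁` is again multiplied into
-- boundaries by the remaining elements, in the shifted complex `F₁ / x F₁ ← F₂ / x F₂ ← ⋯`.
theorem mem_range_of_forall_smul_mem_range {rs : List R}
    (hd : ∀ i, Function.Exact (d (i + 1)) (d i)) (hreg : ∀ i, IsWeaklyRegular (F i) rs)
    (hF : Subsingleton (F rs.length)) {f : F 0}
    (hf : ∀ r ∈ rs, r • f ∈ LinearMap.range (d 0)) : f ∈ LinearMap.range (d 0) := by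
  induction rs generalizing F with
  | nil => exact hF.elim 0 f ▸ zero_mem _
  | cons x rs ih =>
    have hx i : IsSMulRegular (F i) x := ((isWeaklyRegular_cons_iff _ _ _).1 (hreg i)).1
    obtain ⟨g, hg⟩ := hf x List.mem_cons_self
    have hexact i :
        Function.Exact (QuotSMulTop.map x (d (i + 2))) (QuotSMulTop.map x (d (i + 1))) :=
      QuotSMulTop.map_first_exact_on_four_term_exact_of_isSMulRegular_last (hd (i + 1)) (hd i)
        (hx i)
    have hsub : Subsingleton (QuotSMulTop x (F (rs.length + 1))) :=
      have : Subsingleton (F (rs.length + 1)) := hF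
      (Submodule.mkQ_surjective _).subsingleton
    have hsmul : ∀ r ∈ rs, r • (Submodule.Quotient.mk g : QuotSMulTop x (F 1)) ∈
        LinearMap.range (QuotSMulTop.map x (d 1)) := by
      intro r hr
      obtain ⟨g', hg'⟩ := hf r (List.mem_cons_of_mem _ hr)
      obtain ⟨z, hz⟩ := (hd 0 (r • g - x • g')).1 <| by
        rw [map_sub, map_smul, map_smul, hg, hg', smul_comm, sub_self]
      exact ⟨Submodule.Quotient.mk z, quotSMulTop_mk_eq_mk_iff.2
        ⟨-g', (by rw [hz, sub_sub_cancel_left, smul_neg] : x • -g' = d 1 z - r • g)⟩⟩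
    obtain ⟨z, hz⟩ := ih hexact
      (fun i => ((isWeaklyRegular_cons_iff _ _ _).1 (hreg (i + 1))).2) hsub hsmul
    obtain ⟨z, rfl⟩ := Submodule.Quotient.mk_surjective _ z
    obtain ⟨u, hu⟩ : ∃ u, x • u = d 1 z - g := quotSMulTop_mk_eq_mk_iff.1 hz
    have hxu : x • d 0 (-u) = x • f := by
      rw [← map_smul, smul_neg, hu, neg_sub, map_sub, (hd 0).apply_apply_eq_zero, sub_zero, hg]
    exact ⟨-u, hx 0 hxu⟩

variable {E : Type*} [AddCommGroup E] [Module R E] {ε : F 0 →ₗ[R] E} [∀ i, Module.Flat R (F i)]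

theorem nontrivial_of_isAssociatedPrime_maximalIdeal [IsRegularLocalRing R] {n : ℕ}
    (hn : ringKrullDim R = n) (hε : Function.Surjective ε) (hd₀ : Function.Exact (d 0) ε)
    (hd : ∀ i, Function.Exact (d (i + 1)) (d i)) (hE : IsAssociatedPrime (maximalIdeal R) E) :
    Nontrivial (F n) := by
  by_contra h
  obtain ⟨rs, rfl, hmem, hreg⟩ := exists_isWeaklyRegular_of_ringKrullDim_eq R hn
  obtain ⟨hprime, y, hy⟩ := isAssociatedPrime_iff.1 hE
  obtain ⟨f, rfl⟩ := hε y
  have hf : f ∈ LinearMap.range (d 0) :=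
    mem_range_of_forall_smul_mem_range hd (fun i => isWeaklyRegular_of_flat hreg)
      (not_nontrivial_iff_subsingleton.1 h) fun r hr => (hd₀ _).1 <| by
        rw [map_smul]
        simpa [hy] using hmem r hr
  refine hprime.ne_top ((Ideal.eq_top_iff_one _).2 ?_)
  rw [hy, Submodule.mem_colon_singleton, (hd₀ f).2 hf, smul_zero]
  exact zero_mem _

theorem nontrivial_of_isAssociatedPrime_of_height_eq [IsRegularRing R] {P : Ideal R} {h : ℕ}
    (hh : P.height = h) (hε : Function.Surjective ε) (hd₀ : Function.Exact (d 0) ε)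
    (hd : ∀ i, Function.Exact (d (i + 1)) (d i)) (hP : IsAssociatedPrime P E) :
    Nontrivial (F h) := by
  have : P.IsPrime := hP.isPrime
  by_contra hsub
  have : Subsingleton (F h) := not_nontrivial_iff_subsingleton.1 hsub
  have : Nontrivial (LocalizedModule P.primeCompl (F h)) :=
    nontrivial_of_isAssociatedPrime_maximalIdeal (R := Localization.AtPrime P)
      (F := fun i => LocalizedModule P.primeCompl (F i))
      (d := fun i => LocalizedModule.map P.primeCompl (d i))
      (ε := LocalizedModule.map P.primeCompl ε)
      (by rw [IsLocalization.AtPrime.ringKrullDim_eq_height P, hh]; rfl)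
      (LocalizedModule.map_surjective _ _ hε) (LocalizedModule.map_exact _ _ _ hd₀)
      (fun i => LocalizedModule.map_exact _ _ _ (hd i))
      (Module.associatedPrimes.mem_associatedPrimes_atPrime_of_mem_associatedPrimes hP)
  exact not_subsingleton (LocalizedModule P.primeCompl (F h)) inferInstance

end FlatResolution

section AssociatedPrimes

variable {R : Type*} [CommRing R] [IsNoetherianRing R] {P : Ideal R}

theorem isAssociatedPrime_localizedModule {M : Type*} [AddCommGroup M] [Module R M]
    (hP : IsAssociatedPrime P M) {T : Submonoid R} (hT : Disjoint (T : Set R) P) :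
    IsAssociatedPrime P (LocalizedModule T M) := by
  obtain ⟨hprime, x, hx⟩ := isAssociatedPrime_iff.1 hP
  refine isAssociatedPrime_iff.2 ⟨hprime, LocalizedModule.mkLinearMap T M x, ?_⟩
  ext s
  rw [Submodule.mem_colon_singleton, Submodule.mem_bot, ← map_smul,
    IsLocalizedModule.eq_zero_iff T]
  constructor
  · intro hs
    rw [hx, Submodule.mem_colon_singleton] at hs
    exact ⟨1, by rw [one_smul]; exact hs⟩
  · rintro ⟨t, ht⟩
    have hts : (t : R) * s ∈ P := by
      rw [hx, Submodule.mem_colon_singleton, mul_smul]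
      exact ht
    exact (hprime.mem_or_mem hts).resolve_left (Set.disjoint_left.1 hT t.2)

theorem exists_isAssociatedPrime_quotient_of_iInf {κ : Type*} {s : Finset κ} {I : κ → Ideal R}
    (hP : IsAssociatedPrime P (R ⧸ ⨅ i ∈ s, I i)) : ∃ i ∈ s, IsAssociatedPrime P (R ⧸ I i) := by
  obtain ⟨hprime, x, hx⟩ := isAssociatedPrime_iff.1 hP
  obtain ⟨x, rfl⟩ := Ideal.Quotient.mk_surjective x
  have hcolon (J : Ideal R) (r : R) :
      r ∈ (⊥ : Submodule R (R ⧸ J)).colon {Ideal.Quotient.mk J x} ↔ r * x ∈ J := by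
    rw [Submodule.mem_colon_singleton, Submodule.mem_bot, ← Ideal.Quotient.eq_zero_iff_mem, map_mul]
    rfl
  have hinf : P = s.inf fun i => (⊥ : Submodule R (R ⧸ I i)).colon {Ideal.Quotient.mk (I i) x} := by
    ext r
    rw [hx, hcolon]
    simp only [Submodule.mem_finsetInf, hcolon, Submodule.mem_iInf]
  obtain ⟨i, hi, hle⟩ := (Ideal.IsPrime.inf_le' hprime).1 hinf.ge
  exact ⟨i, hi, isAssociatedPrime_iff.2
    ⟨hprime, _, (hinf.le.trans (Finset.inf_le hi)).antisymm hle⟩⟩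

theorem isAssociatedPrime_of_quotient_annihilator (A : Type*) {N : Type*} [CommRing A] [Algebra R A]
    [AddCommGroup N] [Module R N] [Module A N] [IsScalarTower R A N] [Module.Finite A N]
    (hP : IsAssociatedPrime P (R ⧸ Module.annihilator R N)) : IsAssociatedPrime P N := by
  obtain ⟨s, hs⟩ := Module.Finite.fg_top (R := A) (M := N)
  have hann : Module.annihilator R N =
      ⨅ x ∈ s, LinearMap.ker (LinearMap.toSpanSingleton R N x) := by
    ext r
    have hext : (∀ x : N, r • x = 0) ↔ ∀ x ∈ s, r • x = 0 :=
      ⟨fun h x _ => h x, fun h => DFunLike.congr_fun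
        (LinearMap.ext_on hs (f := Module.toModuleEnd A N r) (g := 0) h)⟩
    simpa [Module.mem_annihilator] using hext
  obtain ⟨x, -, hx⟩ := exists_isAssociatedPrime_quotient_of_iInf (hann ▸ hP)
  exact hx.map_of_injective ((LinearMap.ker _).liftQ (LinearMap.toSpanSingleton R N x) le_rfl)
    (LinearMap.ker_eq_bot.1 (Submodule.ker_liftQ_eq_bot' _ _ rfl))

end AssociatedPrimes

theorem mem_annihilator_localizedModule_iff {R M : Type*} [CommRing R] [AddCommGroup M] [Module R M]
    [Module.Finite R M] {T : Submonoid R} {s : R} :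
    s ∈ Module.annihilator R (LocalizedModule T M) ↔
      ∃ t ∈ T, t * s ∈ Module.annihilator R M := by
  simp only [Module.mem_annihilator, mul_smul]
  constructor
  · intro hs
    obtain ⟨t, ht⟩ := Module.Finite.exists_smul_of_comp_eq_of_isLocalizedModule T
      (LocalizedModule.mkLinearMap T M) (Module.toModuleEnd R M s) 0 <| LinearMap.ext fun x => by
        simpa using hs (LocalizedModule.mkLinearMap T M x)
    exact ⟨t, t.2, fun x => (LinearMap.congr_fun ht x).trans (smul_zero _)⟩
  · rintro ⟨t, ht, hts⟩ z
    induction z using LocalizedModule.induction_on with | _ x u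
    refine IsLocalizedModule.smul_injective (LocalizedModule.mkLinearMap T M) ⟨t, ht⟩ ?_
    simp [Submonoid.smul_def, LocalizedModule.smul'_mk, hts]

theorem eq_zero_of_sum_eq_zero_of_mem {I G M ςM : Type*} [DecidableEq G] [AddCommMonoid M]
    [SetLike ςM M] [AddSubmonoidClass ςM M] (ℳ : G → ςM) [DirectSum.Decomposition ℳ]
    {s : Finset I} {e : I → G} (he : Set.InjOn e s) {m : I → M} (hm : ∀ i ∈ s, m i ∈ ℳ (e i))
    (hsum : ∑ i ∈ s, m i = 0) {i : I} (hi : i ∈ s) : m i = 0 := by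
  have hcomp : ∑ j ∈ s, (DirectSum.decompose ℳ (m j) (e i) : M) = m i := by
    rw [Finset.sum_eq_single_of_mem i hi fun j hj hji => DirectSum.decompose_of_mem_ne ℳ (hm j hj)
      fun h => hji (he hj hi h), DirectSum.decompose_of_mem_same ℳ (hm i hi)]
  rw [← hcomp, ← AddSubmonoidClass.coe_finsetSum, ← DFinsupp.finsetSum_apply,
    ← DirectSum.decompose_sum, hsum, DirectSum.decompose_zero]
  rfl

theorem isBaseChange_of_bijective_sum_basis {R A G M N : Type*} [CommSemiring R] [CommSemiring A]
    [Algebra R A] [AddCommMonoid M] [Module R M] [AddCommMonoid N] [Module R N] [Module A N]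
    [IsScalarTower R A N] (b : Module.Basis G R A) (f : M →ₗ[R] N)
    (h : Function.Bijective fun x : G →₀ M => x.sum fun g m => b g • f m) : IsBaseChange A f := by
  classical
  refine (Function.Bijective.of_comp_iff _
    (TensorProduct.equivFinsuppOfBasisLeft b (N := M)).symm.bijective).1 ?_
  convert h using 1
  ext x
  simp only [Function.comp_apply, TensorProduct.equivFinsuppOfBasisLeft_symm_apply, Finsupp.sum,
    map_sum]
  rfl

section BaseChange

variable {R S M₁ M₂ N₁ N₂ : Type*} [CommSemiring R] [CommSemiring S] [Algebra R S]
  [AddCommMonoid M₁] [AddCommMonoid M₂] [Module R M₁] [Module R M₂] [AddCommMonoid N₁]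
  [AddCommMonoid N₂] [Module R N₁] [Module R N₂] [Module S N₁] [Module S N₂]
  [IsScalarTower R S N₁] [IsScalarTower R S N₂] {h₁ : M₁ →ₗ[R] N₁} {h₂ : M₂ →ₗ[R] N₂}
  {f : M₁ →ₗ[R] M₂} {f' : N₁ →ₗ[S] N₂}

theorem isBaseChange_equiv_baseChange (isb₁ : IsBaseChange S h₁) (isb₂ : IsBaseChange S h₂)
    (comm : ∀ x, f' (h₁ x) = h₂ (f x)) (z : TensorProduct R S M₁) :
    f' (isb₁.equiv z) = isb₂.equiv (f.baseChange S z) := by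
  induction z with
  | zero => simp only [map_zero]
  | tmul s x => simp only [IsBaseChange.equiv_tmul, map_smul, comm, LinearMap.baseChange_tmul]
  | add z w hz hw => simp only [map_add, hz, hw]

theorem surjective_of_isBaseChange (isb₁ : IsBaseChange S h₁) (isb₂ : IsBaseChange S h₂)
    (comm : ∀ x, f' (h₁ x) = h₂ (f x)) (hf : Function.Surjective f) : Function.Surjective f' := by
  refine .of_comp (g := isb₁.equiv) ?_
  convert isb₂.equiv.surjective.comp (LinearMap.lTensor_surjective S hf) using 1
  exact funext (isBaseChange_equiv_baseChange isb₁ isb₂ comm)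

theorem bijective_of_isBaseChange (isb₁ : IsBaseChange S h₁) (isb₂ : IsBaseChange S h₂)
    (comm : ∀ x, f' (h₁ x) = h₂ (f x)) (hf : Function.Bijective f) : Function.Bijective f' := by
  refine (Function.Bijective.of_comp_iff f' isb₁.equiv.bijective).1 ?_
  convert isb₂.equiv.bijective.comp
    ((LinearEquiv.ofBijective f hf).baseChange R S M₁ M₂).bijective using 1
  exact funext (isBaseChange_equiv_baseChange isb₁ isb₂ comm)

end BaseChange

theorem exact_of_isBaseChange {R S M₁ M₂ M₃ N₁ N₂ N₃ : Type*} [CommRing R] [CommRing S]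
    [Algebra R S] [Module.Flat R S] [AddCommMonoid M₁] [AddCommMonoid M₂] [AddCommMonoid M₃]
    [Module R M₁] [Module R M₂] [Module R M₃] [AddCommMonoid N₁] [AddCommMonoid N₂]
    [AddCommMonoid N₃] [Module R N₁] [Module R N₂] [Module R N₃] [Module S N₁] [Module S N₂]
    [Module S N₃] [IsScalarTower R S N₁] [IsScalarTower R S N₂] [IsScalarTower R S N₃]
    {h₁ : M₁ →ₗ[R] N₁} {h₂ : M₂ →ₗ[R] N₂} {h₃ : M₃ →ₗ[R] N₃} {f : M₁ →ₗ[R] M₂} {f' : N₁ →ₗ[S] N₂}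
    {g : M₂ →ₗ[R] M₃} {g' : N₂ →ₗ[S] N₃} (isb₁ : IsBaseChange S h₁) (isb₂ : IsBaseChange S h₂)
    (isb₃ : IsBaseChange S h₃) (comm₁ : ∀ x, f' (h₁ x) = h₂ (f x))
    (comm₂ : ∀ x, g' (h₂ x) = h₃ (g x)) (hfg : Function.Exact f g) : Function.Exact f' g' := by
  let := Module.addCommMonoidToAddCommGroup R (M := M₁)
  let := Module.addCommMonoidToAddCommGroup R (M := M₂)
  let := Module.addCommMonoidToAddCommGroup R (M := M₃)
  refine (Function.Exact.iff_of_ladder_addEquiv (f₁₂ := (f.baseChange S).toAddMonoidHom)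
    (f₂₃ := (g.baseChange S).toAddMonoidHom) (g₁₂ := f'.toAddMonoidHom)
    (g₂₃ := g'.toAddMonoidHom) isb₁.equiv.toAddEquiv isb₂.equiv.toAddEquiv
    isb₃.equiv.toAddEquiv ?_ ?_).2 (Module.Flat.lTensor_exact S hfg)
  · exact DFunLike.ext _ _ (isBaseChange_equiv_baseChange isb₁ isb₂ comm₁)
  · exact DFunLike.ext _ _ (isBaseChange_equiv_baseChange isb₂ isb₃ comm₂)

namespace SmoothProjectiveFan

variable {n : ℕ} {ι : Type*} [Fintype ι] [DecidableEq ι] (X : SmoothProjectiveFan n ι)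

section HomogeneousFractions

variable {k : Type*} [Field k] {M ςM : Type*} [AddCommGroup M] [Module (X.Cox k) M] [SetLike ςM M]

/-- The fractions of degree `d` in the localization of a graded module at the powers of
`X.hat k σ`, encoded without a choice of denominator. Those of degree `0` are the sections over
`U_σ`; since the Cox ring is graded by submodules and modules by subgroups, `ςM` is arbitrary. -/
def IsHomogeneousFraction (ℳ : X.Pic → ςM) (σ : Finset ι) (d : X.Pic)
    (z : LocalizedModule (X.hatPowers k σ) M) : Prop :=
  ∃ t : ℕ, ∃ m ∈ ℳ (t • X.hatDeg σ + d),
    X.hat k σ ^ t • z = LocalizedModule.mkLinearMap (X.hatPowers k σ) M m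

theorem eq_mk_hatPow_iff {σ : Finset ι} {z : LocalizedModule (X.hatPowers k σ) M} {m : M} {t : ℕ} :
    z = LocalizedModule.mk m (X.hatPow k σ t) ↔
      X.hat k σ ^ t • z = LocalizedModule.mkLinearMap (X.hatPowers k σ) M m := by
  rw [IsLocalizedModule.mk_eq_mk', eq_comm, IsLocalizedModule.mk'_eq_iff, eq_comm]
  rfl

theorem isHomogeneousFraction_zero_iff_mem_sections (ℳ : X.Pic → AddSubgroup M)
    [SetLike.GradedSMul (X.grading k) ℳ] {σ : Finset ι}
    {z : LocalizedModule (X.hatPowers k σ) M} :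
    X.IsHomogeneousFraction ℳ σ 0 z ↔ z ∈ X.sections k ℳ σ := by
  simp only [IsHomogeneousFraction, add_zero, ← eq_mk_hatPow_iff]
  rfl

theorem isHomogeneousFraction_zero_iff_mem_chartRing {σ : Finset ι}
    {z : Localization (X.hatPowers k σ)} :
    X.IsHomogeneousFraction (X.grading k) σ 0 z ↔ z ∈ X.chartRing k σ := by
  simp only [IsHomogeneousFraction, add_zero, ← eq_mk_hatPow_iff]
  rfl

theorem eq_zero_of_hat_pow_smul_eq_zero {σ : Finset ι} {t : ℕ}
    {z : LocalizedModule (X.hatPowers k σ) M} (h : X.hat k σ ^ t • z = 0) : z = 0 :=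
  IsLocalizedModule.smul_injective (LocalizedModule.mkLinearMap (X.hatPowers k σ) M)
    (X.hatPow k σ t) (h.trans (smul_zero _).symm)

variable {X} {ℳ : X.Pic → ςM} {σ : Finset ι} {d : X.Pic} {z : LocalizedModule (X.hatPowers k σ) M}

theorem IsHomogeneousFraction.mk {m : M} (hm : m ∈ ℳ d) (t : ℕ) :
    X.IsHomogeneousFraction ℳ σ (d - t • X.hatDeg σ) (LocalizedModule.mk m (X.hatPow k σ t)) :=
  ⟨t, m, by rwa [add_sub_cancel], X.eq_mk_hatPow_iff.1 rfl⟩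

variable (ℳ) in
theorem IsHomogeneousFraction.induction [AddSubmonoidClass ςM M] [DirectSum.Decomposition ℳ]
    {p : LocalizedModule (X.hatPowers k σ) M → Prop}
    (homogeneous : ∀ d z, X.IsHomogeneousFraction ℳ σ d z → p z)
    (add : ∀ z w, p z → p w → p (z + w)) (z : LocalizedModule (X.hatPowers k σ) M) : p z := by
  induction z using LocalizedModule.induction_on with | _ m s
  obtain ⟨_, t, rfl⟩ := s
  induction m using DirectSum.Decomposition.inductionOn ℳ with
  | zero => exact homogeneous 0 _ ⟨0, 0, zero_mem _, by rw [LocalizedModule.zero_mk]; simp⟩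
  | homogeneous m => exact homogeneous _ _ (mk m.2 t)
  | add m m' hm hm' =>
    simp only [IsLocalizedModule.mk_eq_mk', IsLocalizedModule.mk'_add] at hm hm' ⊢
    exact add _ _ hm hm'

variable [SetLike.GradedSMul (X.grading k) ℳ]

theorem hat_pow_smul_mem {m : M} (hm : m ∈ ℳ d) (t : ℕ) :
    X.hat k σ ^ t • m ∈ ℳ (t • X.hatDeg σ + d) :=
  SetLike.GradedSMul.smul_mem (X.hat_pow_mem σ t) hm

namespace IsHomogeneousFraction

theorem eventually (hz : X.IsHomogeneousFraction ℳ σ d z) :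
    ∀ᶠ t : ℕ in Filter.atTop, ∃ m ∈ ℳ (t • X.hatDeg σ + d),
      X.hat k σ ^ t • z = LocalizedModule.mkLinearMap (X.hatPowers k σ) M m := by
  obtain ⟨t, m, hm, hmz⟩ := hz
  filter_upwards [Filter.eventually_ge_atTop t] with t' ht
  obtain ⟨j, rfl⟩ := Nat.exists_eq_add_of_le' ht
  refine ⟨X.hat k σ ^ j • m, ?_, by rw [pow_add, mul_smul, hmz, map_smul]⟩
  rw [add_smul, add_assoc]
  exact hat_pow_smul_mem hm j

theorem smul {a : Localization (X.hatPowers k σ)} {e : X.Pic}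
    (ha : X.IsHomogeneousFraction (X.grading k) σ e a) (hz : X.IsHomogeneousFraction ℳ σ d z) :
    X.IsHomogeneousFraction ℳ σ (e + d) (a • z) := by
  obtain ⟨t, s, hs, hsa⟩ := ha
  obtain ⟨t', m, hm, hmz⟩ := hz
  refine ⟨t + t', s • m, ?_, ?_⟩
  · rw [add_smul, add_add_add_comm]
    exact SetLike.GradedSMul.smul_mem hs hm
  · have hsa' : X.hat k σ ^ t • a = algebraMap _ (Localization (X.hatPowers k σ)) s := hsa
    rw [pow_add, mul_smul, smul_comm _ a, hmz, ← smul_assoc, hsa', algebraMap_smul, map_smul]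

variable [AddSubmonoidClass ςM M] [DirectSum.Decomposition ℳ]

theorem eq_zero_of_sum_eq_zero {s : Finset X.Pic}
    {f : X.Pic → LocalizedModule (X.hatPowers k σ) M}
    (hf : ∀ d ∈ s, X.IsHomogeneousFraction ℳ σ d (f d)) (hsum : ∑ d ∈ s, f d = 0)
    (hd : d ∈ s) : f d = 0 := by
  obtain ⟨t, ht⟩ :=
    ((Filter.eventually_all_finset s).2 fun d hd => (hf d hd).eventually).exists
  choose! m hm hmf using ht
  have hsum' : LocalizedModule.mkLinearMap (X.hatPowers k σ) M (∑ d ∈ s, m d) = 0 := by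
    rw [map_sum, ← Finset.sum_congr rfl hmf, ← Finset.smul_sum, hsum, smul_zero]
  obtain ⟨⟨_, j, rfl⟩, hj⟩ := (IsLocalizedModule.eq_zero_iff (X.hatPowers k σ) _).1 hsum'
  have hmd : X.hat k σ ^ j • m d = 0 := by
    refine eq_zero_of_sum_eq_zero_of_mem ℳ (s := s) (m := fun d => X.hat k σ ^ j • m d)
      (e := fun d => j • X.hatDeg σ + (t • X.hatDeg σ + d))
      ((add_right_injective _).comp (add_right_injective _)).injOn
      (fun d hd => hat_pow_smul_mem (hm d hd) j) ?_ hd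
    rw [← Finset.smul_sum]
    exact hj
  refine X.eq_zero_of_hat_pow_smul_eq_zero (t := t) (X.eq_zero_of_hat_pow_smul_eq_zero (t := j) ?_)
  rw [hmf d hd, ← map_smul, hmd, map_zero]

end IsHomogeneousFraction

end HomogeneousFractions

section HomogeneousUnits

variable {X} {σ : Finset ι}

theorem exists_divMap_eq (hσ : σ ∈ X.cones) (D : ι → ℤ) : ∃ m, ∀ ρ ∈ σ, X.divMap m ρ = D ρ := by
  obtain ⟨b, e, he, hb⟩ := X.smooth σ hσ
  let φ : (Fin n → ℤ) →ₗ[ℤ] ℤ :=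
    b.constr ℤ (Function.extend (fun ρ : σ => e ρ) (fun ρ => D ρ) 0)
  refine ⟨fun i => φ fun j => if i = j then 1 else 0, fun ρ hρ => ?_⟩
  have hφ : φ (X.gen ρ) = D ρ := by
    rw [← hb ρ hρ, Module.Basis.constr_basis]
    exact he.injective.extend_apply (fun ρ : σ => D ρ) 0 ⟨ρ, hρ⟩
  rw [← hφ, φ.pi_apply_eq_sum_univ]
  rfl

theorem closure_varDeg_compl_eq_top (hσ : σ ∈ X.cones) :
    AddSubgroup.closure (X.varDeg '' (σ : Set ι)ᶜ) = ⊤ := by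
  refine (AddSubgroup.eq_top_iff' _).2 fun d => ?_
  obtain ⟨D, rfl⟩ := Submodule.Quotient.mk_surjective _ d
  obtain ⟨m, hm⟩ := exists_divMap_eq hσ D
  have hdiv : (Submodule.Quotient.mk D : X.Pic) = Submodule.Quotient.mk (D - X.divMap m) :=
    (Submodule.Quotient.eq _).2 ⟨m, (sub_sub_cancel _ _).symm⟩
  have hsum : (Submodule.Quotient.mk (D - X.divMap m) : X.Pic) =
      ∑ ρ, (D - X.divMap m) ρ • X.varDeg ρ := by
    simp only [varDeg, ← Submodule.mkQ_apply, ← map_smul, ← map_sum, ← Pi.single_smul, smul_eq_mul,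
      mul_one, Finset.univ_sum_single]
  rw [hdiv, hsum]
  refine sum_mem fun ρ _ => ?_
  by_cases hρ : ρ ∈ (σ : Set ι)
  · rw [Pi.sub_apply, hm ρ hρ, sub_self, zero_smul]
    exact zero_mem _
  · exact zsmul_mem (AddSubgroup.subset_closure (Set.mem_image_of_mem _ hρ)) _

variable (X σ) (k : Type*) [Field k]

/-- The degrees of the homogeneous units of the localization of the Cox ring at the powers of
`X.hat k σ`. The degree of the inverse is imposed too, so that no uniqueness of degrees is needed to
see that these form a subgroup. -/
def unitDegrees : AddSubgroup X.Pic where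
  carrier := {d | ∃ u : (Localization (X.hatPowers k σ))ˣ,
    X.IsHomogeneousFraction (X.grading k) σ d (u : Localization (X.hatPowers k σ)) ∧
    X.IsHomogeneousFraction (X.grading k) σ (-d) (↑u⁻¹ : Localization (X.hatPowers k σ))}
  zero_mem' := by
    have h := X.isHomogeneousFraction_zero_iff_mem_chartRing.2 (one_mem (X.chartRing k σ))
    exact ⟨1, h, by simpa using h⟩
  add_mem' := by
    rintro d e ⟨u, hu, hu'⟩ ⟨v, hv, hv'⟩
    refine ⟨u * v, hu.smul hv, ?_⟩
    rw [neg_add, mul_inv u v]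
    exact hu'.smul hv'
  neg_mem' := by
    rintro d ⟨u, hu, hu'⟩
    exact ⟨u⁻¹, hu', by rwa [inv_inv, neg_neg]⟩

theorem varDeg_mem_unitDegrees {ρ : ι} (hρ : ρ ∉ σ) : X.varDeg ρ ∈ X.unitDegrees σ k := by
  have hmul : MvPolynomial.X ρ * ∏ τ ∈ σᶜ.erase ρ, MvPolynomial.X τ = X.hat k σ :=
    Finset.mul_prod_erase _ _ (Finset.mem_compl.2 hρ)
  have hdeg : X.varDeg ρ + ∑ τ ∈ σᶜ.erase ρ, X.varDeg τ = X.hatDeg σ :=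
    Finset.add_sum_erase _ _ (Finset.mem_compl.2 hρ)
  have hhat : IsUnit (algebraMap _ (Localization (X.hatPowers k σ)) (X.hat k σ)) :=
    IsLocalization.map_units _ (⟨X.hat k σ, Submonoid.mem_powers _⟩ : X.hatPowers k σ)
  rw [← hmul, map_mul] at hhat
  obtain ⟨u, hu⟩ := isUnit_of_mul_isUnit_left hhat
  refine ⟨u, ⟨0, MvPolynomial.X ρ, ?_, ?_⟩, ⟨1, ∏ τ ∈ σᶜ.erase ρ, MvPolynomial.X τ, ?_, ?_⟩⟩
  · rw [zero_smul, zero_add]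
    exact MvPolynomial.isWeightedHomogeneous_X k X.varDeg ρ
  · rw [pow_zero, one_smul, hu]
    rfl
  · rw [one_smul, ← hdeg, ← sub_eq_add_neg, add_sub_cancel_left]
    exact SetLike.prod_mem_graded (A := X.grading k) X.varDeg _
      fun τ _ => MvPolynomial.isWeightedHomogeneous_X k X.varDeg τ
  · rw [pow_one, ← hmul, Algebra.smul_def, map_mul, ← hu]
    exact (mul_right_comm _ _ _).trans (by rw [Units.mul_inv, one_mul]; rfl)

theorem exists_homogeneous_unit (hσ : σ ∈ X.cones) (d : X.Pic) :
    ∃ u : (Localization (X.hatPowers k σ))ˣ,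
      X.IsHomogeneousFraction (X.grading k) σ d (u : Localization (X.hatPowers k σ)) ∧
      X.IsHomogeneousFraction (X.grading k) σ (-d) (↑u⁻¹ : Localization (X.hatPowers k σ)) := by
  have htop : X.unitDegrees σ k = ⊤ := by
    rw [eq_top_iff, ← closure_varDeg_compl_eq_top hσ, AddSubgroup.closure_le]
    rintro _ ⟨ρ, hρ, rfl⟩
    exact X.varDeg_mem_unitDegrees σ k hρ
  exact (htop.symm ▸ AddSubgroup.mem_top d : d ∈ X.unitDegrees σ k)

end HomogeneousUnits

section BaseChange

variable {X} {k : Type*} [Field k] {M ςM : Type*} [AddCommGroup M] [Module (X.Cox k) M]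
  [SetLike ςM M] [AddSubmonoidClass ςM M] {σ : Finset ι}

theorem bijective_sum_unit_smul (ℳ : X.Pic → ςM) [SetLike.GradedSMul (X.grading k) ℳ]
    [DirectSum.Decomposition ℳ] {u : X.Pic → (Localization (X.hatPowers k σ))ˣ}
    (hu : ∀ d, X.IsHomogeneousFraction (X.grading k) σ d (u d : Localization (X.hatPowers k σ)))
    (hu' : ∀ d,
      X.IsHomogeneousFraction (X.grading k) σ (-d) (↑(u d)⁻¹ : Localization (X.hatPowers k σ)))
    {T : Type*} [AddCommGroup T] {f : T →+ LocalizedModule (X.hatPowers k σ) M}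
    (hf : Function.Injective f) (hrange : ∀ z, X.IsHomogeneousFraction ℳ σ 0 z ↔ z ∈ f.range) :
    Function.Bijective fun x : X.Pic →₀ T =>
      x.sum fun d m => (u d : Localization (X.hatPowers k σ)) • f m := by
  let Φ : (X.Pic →₀ T) →+ LocalizedModule (X.hatPowers k σ) M := Finsupp.liftAddHom fun d =>
    (DistribSMul.toAddMonoidHom _ (u d : Localization (X.hatPowers k σ))).comp f
  constructor
  · refine (injective_iff_map_eq_zero Φ).2 fun x hx => ?_
    by_contra hne
    obtain ⟨d, hd⟩ := Finsupp.support_nonempty_iff.2 hne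
    have hzero : (u d : Localization (X.hatPowers k σ)) • f (x d) = 0 :=
      IsHomogeneousFraction.eq_zero_of_sum_eq_zero (ℳ := ℳ)
        (f := fun d => (u d : Localization (X.hatPowers k σ)) • f (x d))
        (fun e _ => by simpa using (hu e).smul ((hrange _).2 ⟨x e, rfl⟩)) hx hd
    exact Finsupp.mem_support_iff.1 hd <|
      hf (((u d).isUnit.smul_eq_zero.1 hzero).trans (map_zero f).symm)
  · refine IsHomogeneousFraction.induction ℳ (fun d z hz => ?_) ?_
    · obtain ⟨m, hm⟩ := (hrange _).1 (neg_add_cancel d ▸ (hu' d).smul hz)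
      exact ⟨Finsupp.single d m, by simp [hm, smul_smul]⟩
    · rintro _ _ ⟨x, rfl⟩ ⟨y, rfl⟩
      exact ⟨x + y, map_add Φ x y⟩

variable (X k) in
theorem exists_basis_homogeneous_units (hσ : σ ∈ X.cones) :
    ∃ (u : X.Pic → (Localization (X.hatPowers k σ))ˣ)
      (b : Module.Basis X.Pic (X.chartRing k σ) (Localization (X.hatPowers k σ))),
      (∀ d, b d = u d) ∧
      (∀ d, X.IsHomogeneousFraction (X.grading k) σ d (u d : Localization (X.hatPowers k σ))) ∧
      ∀ d, X.IsHomogeneousFraction (X.grading k) σ (-d)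
        (↑(u d)⁻¹ : Localization (X.hatPowers k σ)) := by
  choose u hu hu' using X.exists_homogeneous_unit σ k hσ
  have hbij := bijective_sum_unit_smul (X.grading k) hu hu'
    (f := (X.chartRing k σ).toSubring.subtype.toAddMonoidHom) Subtype.val_injective fun z => by
      rw [isHomogeneousFraction_zero_iff_mem_chartRing]
      exact ⟨fun hz => ⟨⟨z, hz⟩, rfl⟩, fun ⟨w, hw⟩ => hw ▸ w.2⟩
  let b : Module.Basis X.Pic (X.chartRing k σ) (Localization (X.hatPowers k σ)) := .ofRepr <|
    .symm <| .ofBijective (Finsupp.linearCombination (X.chartRing k σ) fun d =>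
      (u d : Localization (X.hatPowers k σ))) <| by
        convert hbij using 1
        ext x
        refine Finsupp.sum_congr fun d _ => ?_
        exact mul_comm (x d : Localization (X.hatPowers k σ)) (u d)
  refine ⟨u, b, fun d => ?_, hu, hu'⟩
  simp [b]

variable (k) in
theorem flat_localization (hσ : σ ∈ X.cones) :
    Module.Flat (X.chartRing k σ) (Localization (X.hatPowers k σ)) :=
  have ⟨_, b, _⟩ := X.exists_basis_homogeneous_units k hσ
  have := Module.Free.of_basis b
  inferInstance

variable (k) in
theorem isBaseChange_sections_subtype (ℳ : X.Pic → AddSubgroup M)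
    [SetLike.GradedSMul (X.grading k) ℳ] [DirectSum.Decomposition ℳ] (hσ : σ ∈ X.cones) :
    IsBaseChange (Localization (X.hatPowers k σ)) (X.sections k ℳ σ).subtype := by
  let := Module.addCommMonoidToAddCommGroup (X.chartRing k σ) (M := X.sections k ℳ σ)
  obtain ⟨u, b, hb, hu, hu'⟩ := X.exists_basis_homogeneous_units k hσ
  refine isBaseChange_of_bijective_sum_basis (R := X.chartRing k σ)
    (A := Localization (X.hatPowers k σ)) b (X.sections k ℳ σ).subtype ?_
  simp only [hb]
  exact bijective_sum_unit_smul ℳ hu hu' (T := X.sections k ℳ σ)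
    (f := (X.sections k ℳ σ).subtype.toAddMonoidHom) Subtype.val_injective fun z => by
      rw [isHomogeneousFraction_zero_iff_mem_sections]
      exact ⟨fun hz => ⟨⟨z, hz⟩, rfl⟩, fun ⟨w, hw⟩ => hw ▸ w.2⟩

end BaseChange

section FreeModules

variable (k : Type*) [Field k] {r : ℕ} (a : Fin r → X.Pic)

theorem single_mem_freeGrading {j : Fin r} {d : X.Pic} {s : X.Cox k} (hs : s ∈ X.grading k d) :
    Pi.single j s ∈ X.freeGrading k a (d + a j) := by
  intro l
  rcases eq_or_ne l j with rfl | h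
  · rwa [Pi.single_eq_same, add_sub_cancel_right]
  · rw [Pi.single_eq_of_ne h]
    exact zero_mem _

theorem isInternal_freeGrading : DirectSum.IsInternal (X.freeGrading k a) := by
  classical
  constructor
  · refine (injective_iff_map_eq_zero _).2 fun x hx => ?_
    rw [DirectSum.coeAddMonoidHom_eq_dfinsuppSum] at hx
    by_contra hne
    obtain ⟨d, hd⟩ := Finset.nonempty_iff_ne_empty.2 (mt DFinsupp.support_eq_empty.1 hne)
    refine DFinsupp.mem_support_iff.1 hd (Subtype.ext (funext fun j => ?_))
    refine eq_zero_of_sum_eq_zero_of_mem (X.grading k) (m := fun d => (x d).1 j)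
      (sub_left_injective (b := a j)).injOn (fun d _ => (x d).2 j) ?_ hd
    simpa [DFinsupp.sum] using congrFun hx j
  · refine fun f => (?_ : f ∈ (DirectSum.coeAddMonoidHom (X.freeGrading k a)).range)
    rw [← Finset.univ_sum_single f]
    refine sum_mem fun j _ => ?_
    induction f j using DirectSum.Decomposition.inductionOn (X.grading k) with
    | zero => rw [Pi.single_zero]; exact zero_mem _
    | homogeneous s =>
      exact ⟨_, DirectSum.coeAddMonoidHom_of _ _ ⟨_, X.single_mem_freeGrading k a s.2⟩⟩
    | add s t hs ht => rw [Pi.single_add]; exact add_mem hs ht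

noncomputable instance instDecompositionFreeGrading :
    DirectSum.Decomposition (X.freeGrading k a) :=
  (X.isInternal_freeGrading k a).chooseDecomposition

end FreeModules

end SmoothProjectiveFan

namespace SmoothProjectiveFan

variable {n : ℕ} {ι : Type*} [Fintype ι] [DecidableEq ι] {X : SmoothProjectiveFan n ι} {k : Type*}
  [Field k] {σ : Finset ι} {M N : Type*} [AddCommGroup M] [Module (X.Cox k) M] [AddCommGroup N]
  [Module (X.Cox k) N]

section Charts

variable {ℳ : X.Pic → AddSubgroup M} [SetLike.GradedSMul (X.grading k) ℳ]
  {𝒩 : X.Pic → AddSubgroup N} [SetLike.GradedSMul (X.grading k) 𝒩] [DirectSum.Decomposition 𝒩]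

theorem exists_linearMap_localizedModule_of_sections (hσ : σ ∈ X.cones)
    (φ : X.sections k 𝒩 σ →ₗ[X.chartRing k σ] X.sections k ℳ σ) :
    ∃ ψ : LocalizedModule (X.hatPowers k σ) N →ₗ[Localization (X.hatPowers k σ)]
        LocalizedModule (X.hatPowers k σ) M, ∀ z : X.sections k 𝒩 σ, ψ z = φ z :=
  ⟨(isBaseChange_sections_subtype k 𝒩 hσ).lift ((X.sections k ℳ σ).subtype ∘ₗ φ),
    (isBaseChange_sections_subtype k 𝒩 hσ).lift_eq _⟩

theorem IsVirtualResolution.exists_exact_localizedModule [DirectSum.Decomposition ℳ]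
    {F : X.FreeComplex k} (hF : X.IsVirtualResolution k ℳ F) (hσ : σ ∈ X.cones) :
    ∃ ε : LocalizedModule (X.hatPowers k σ) (Fin (F.rank 0) → X.Cox k)
        →ₗ[Localization (X.hatPowers k σ)] LocalizedModule (X.hatPowers k σ) M,
      Function.Surjective ε ∧
      Function.Exact (LocalizedModule.map (X.hatPowers k σ) (F.d 0)) ε ∧
      ∀ i, Function.Exact (LocalizedModule.map (X.hatPowers k σ) (F.d (i + 1)))
        (LocalizedModule.map (X.hatPowers k σ) (F.d i)) := by
  obtain ⟨ε, hε⟩ := hF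
  obtain ⟨hsurj, hexact₀, hexact⟩ := hε σ hσ
  obtain ⟨ψ, hψ⟩ := exists_linearMap_localizedModule_of_sections hσ (ε.app σ hσ)
  have := flat_localization k hσ
  have hF (i : ℕ) := isBaseChange_sections_subtype k (X.freeGrading k (F.twist i)) hσ
  have hd (i : ℕ) (z : X.sections k (X.freeGrading k (F.twist (i + 1))) σ) :
      LocalizedModule.map (X.hatPowers k σ) (F.d i) z = F.dSections i σ z := rfl
  have hM := isBaseChange_sections_subtype k ℳ hσ
  refine ⟨ψ, surjective_of_isBaseChange (hF 0) hM hψ hsurj, ?_, fun i => ?_⟩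
  · exact exact_of_isBaseChange (R := X.chartRing k σ) (f := F.dSections 0 σ) (g := ε.app σ hσ)
      (hF (0 + 1)) (hF 0) hM (hd 0) hψ hexact₀
  · exact exact_of_isBaseChange (R := X.chartRing k σ) (f := F.dSections (i + 1) σ)
      (g := F.dSections i σ) (hF (i + 2)) (hF (i + 1)) (hF i) (hd (i + 1)) (hd i) (hexact i)

theorem SheafIso.nonempty_linearEquiv_localizedModule [DirectSum.Decomposition ℳ]
    (h : X.SheafIso k 𝒩 ℳ) (hσ : σ ∈ X.cones) :
    Nonempty (LocalizedModule (X.hatPowers k σ) N ≃ₗ[X.Cox k]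
      LocalizedModule (X.hatPowers k σ) M) := by
  obtain ⟨φ, hφ⟩ := h
  obtain ⟨ψ, hψ⟩ := exists_linearMap_localizedModule_of_sections hσ (φ.app σ hσ)
  have hbij : Function.Bijective ψ := bijective_of_isBaseChange
    (isBaseChange_sections_subtype k 𝒩 hσ) (isBaseChange_sections_subtype k ℳ hσ) hψ (hφ σ hσ)
  exact ⟨.ofBijective (ψ.restrictScalars (X.Cox k)) hbij⟩

theorem height_le_vdim [DirectSum.Decomposition ℳ] (hσ : σ ∈ X.cones) {P : Ideal (X.Cox k)}
    (hP : IsAssociatedPrime P (LocalizedModule (X.hatPowers k σ) M)) :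
    P.height ≤ X.vdim k ℳ := by
  refine le_iInf₂ fun F hF => ?_
  obtain ⟨ε, hsurj, hexact₀, hexact⟩ := hF.exists_exact_localizedModule hσ
  have : P.IsPrime := hP.isPrime
  obtain ⟨h, hh⟩ := ENat.ne_top_iff_exists.1 (Ideal.height_ne_top_of_isPrime (I := P))
  have : IsRegularRing (X.Cox k) := MvPolynomial.isRegularRing_of_isRegularRing k
  have (i : ℕ) : Module.Flat (X.Cox k)
      (LocalizedModule (X.hatPowers k σ) (Fin (F.rank i) → X.Cox k)) :=
    have := Module.Flat.of_isLocalizedModule (Localization (X.hatPowers k σ)) (X.hatPowers k σ)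
      (LocalizedModule.mkLinearMap (X.hatPowers k σ) (Fin (F.rank i) → X.Cox k))
    have := IsLocalization.flat (Localization (X.hatPowers k σ)) (X.hatPowers k σ)
    .trans (X.Cox k) (Localization (X.hatPowers k σ)) _
  have : Nontrivial (LocalizedModule (X.hatPowers k σ) (Fin (F.rank h) → X.Cox k)) :=
    nontrivial_of_isAssociatedPrime_of_height_eq
      (F := fun i => LocalizedModule (X.hatPowers k σ) (Fin (F.rank i) → X.Cox k))
      (d := fun i => (LocalizedModule.map (X.hatPowers k σ) (F.d i)).restrictScalars (X.Cox k))
      (ε := ε.restrictScalars (X.Cox k)) hh.symm hsurj hexact₀ hexact hP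
  have hrank : F.rank h ≠ 0 := fun h0 => by
    have : IsEmpty (Fin (F.rank h)) := h0 ▸ Fin.isEmpty
    exact not_subsingleton (LocalizedModule (X.hatPowers k σ) (Fin (F.rank h) → X.Cox k))
      inferInstance
  rw [← hh]
  exact le_iSup₂ (f := fun (i : ℕ) (_ : F.rank i ≠ 0) => (i : ℕ∞)) h hrank

end Charts

section Saturation

theorem exists_irrelevant_pow_le_iff {I : Ideal (X.Cox k)} :
    (∃ t : ℕ, X.irrelevant k ^ t ≤ I) ↔ ∀ σ ∈ X.cones, ∃ t : ℕ, X.hat k σ ^ t ∈ I := by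
  refine ⟨fun ⟨t, ht⟩ σ hσ =>
    ⟨t, ht (Ideal.pow_mem_pow (Ideal.subset_span (Set.mem_image_of_mem _ hσ)) t)⟩, fun h => ?_⟩
  refine Ideal.exists_pow_le_of_le_radical_of_fg (Ideal.span_le.2 ?_) (IsNoetherian.noetherian _)
  rintro _ ⟨σ, hσ, rfl⟩
  exact h σ hσ

theorem mem_saturation_iff {I : Ideal (X.Cox k)} {s : X.Cox k} :
    s ∈ X.saturation k I ↔ ∀ σ ∈ X.cones, ∃ t : ℕ, X.hat k σ ^ t * s ∈ I := by
  have hdir : Directed (· ≤ ·) fun t : ℕ =>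
      Submodule.colon I (X.irrelevant k ^ t : Ideal (X.Cox k)) :=
    Monotone.directed_le fun i j hij => Submodule.colon_mono le_rfl (Ideal.pow_le_pow_right hij)
  have hcolon (t : ℕ) : s ∈ Submodule.colon I (X.irrelevant k ^ t : Ideal (X.Cox k)) ↔
      X.irrelevant k ^ t ≤ I.colon {s} := by
    simp only [Submodule.mem_colon, SetLike.le_def, smul_eq_mul, SetLike.mem_coe,
      Set.mem_singleton_iff, forall_eq, mul_comm s]
  simp only [saturation, Submodule.mem_iSup_of_directed _ hdir, hcolon,
    exists_irrelevant_pow_le_iff, Submodule.mem_colon_singleton, smul_eq_mul]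

theorem le_saturation (I : Ideal (X.Cox k)) : I ≤ X.saturation k I :=
  fun _ hs => mem_saturation_iff.2 fun _ _ => ⟨0, I.mul_mem_left _ hs⟩

variable (M) in
theorem saturation_annihilator [Module.Finite (X.Cox k) M] :
    X.saturation k (Module.annihilator (X.Cox k) M) =
      ⨅ σ ∈ X.cones, Module.annihilator (X.Cox k) (LocalizedModule (X.hatPowers k σ) M) := by
  ext s
  simp only [mem_saturation_iff, Submodule.mem_iInf, mem_annihilator_localizedModule_iff,
    Submonoid.mem_powers_iff, exists_exists_eq_and]

theorem IsSaturated.eq_zero_of_forall_mkLinearMap_eq_zero (hM : X.IsSaturated k M) {m : M}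
    (hm : ∀ σ ∈ X.cones, LocalizedModule.mkLinearMap (X.hatPowers k σ) M m = 0) : m = 0 := by
  obtain ⟨t, ht⟩ := exists_irrelevant_pow_le_iff (I := (⊥ : Submodule (X.Cox k) M).colon {m}).2
    fun σ hσ => by
      obtain ⟨⟨_, j, rfl⟩, hj⟩ := (IsLocalizedModule.eq_zero_iff (X.hatPowers k σ) _).1 (hm σ hσ)
      exact ⟨j, Submodule.mem_colon_singleton.2 hj⟩
  exact hM m ⟨t, fun b hb => Submodule.mem_colon_singleton.1 (ht hb)⟩

theorem IsSaturated.annihilator_eq (hM : X.IsSaturated k M) :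
    Module.annihilator (X.Cox k) M =
      ⨅ σ ∈ X.cones, Module.annihilator (X.Cox k) (LocalizedModule (X.hatPowers k σ) M) := by
  ext s
  simp only [Submodule.mem_iInf, Module.mem_annihilator]
  constructor
  · intro hs σ _ z
    induction z using LocalizedModule.induction_on with | _ m t
    rw [LocalizedModule.smul'_mk, hs, LocalizedModule.zero_mk]
  · exact fun hs m => hM.eq_zero_of_forall_mkLinearMap_eq_zero fun σ hσ => by
      rw [map_smul, hs σ hσ]

theorem IsSaturated.isRelevant_of_isAssociatedPrime (hM : X.IsSaturated k M) {P : Ideal (X.Cox k)}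
    (hP : IsAssociatedPrime P M) : X.IsRelevant k P := by
  obtain ⟨hprime, m, rfl⟩ := isAssociatedPrime_iff.1 hP
  refine fun t _ ht => hprime.ne_top ?_
  rw [hM m ⟨t, fun b hb => Submodule.mem_colon_singleton.1 (ht hb)⟩]
  simp

theorem IsRelevant.exists_isAssociatedPrime_localizedModule {P : Ideal (X.Cox k)}
    (hrel : X.IsRelevant k P) (hP : IsAssociatedPrime P M) :
    ∃ σ ∈ X.cones, IsAssociatedPrime P (LocalizedModule (X.hatPowers k σ) M) := by
  obtain ⟨_, ⟨σ, hσ, rfl⟩, hσP⟩ : ∃ b ∈ X.hat k '' X.cones, b ∉ P := by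
    by_contra! h
    exact hrel 1 le_rfl (by rw [pow_one]; exact Ideal.span_le.2 h)
  refine ⟨σ, hσ, isAssociatedPrime_localizedModule hP (Set.disjoint_left.2 ?_)⟩
  rintro _ ⟨t, rfl⟩ ht
  exact hσP (hP.isPrime.mem_of_pow_mem t ht)

theorem exists_isAssociatedPrime_localizedModule_of_saturation [Module.Finite (X.Cox k) M]
    {P : Ideal (X.Cox k)} (hP : IsAssociatedPrime P
      (X.Cox k ⧸ X.saturation k (Module.annihilator (X.Cox k) M))) :
    ∃ σ ∈ X.cones, IsAssociatedPrime P (LocalizedModule (X.hatPowers k σ) M) := by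
  rw [saturation_annihilator] at hP
  obtain ⟨σ, hσ, hPσ⟩ := exists_isAssociatedPrime_quotient_of_iInf hP
  have : Module.Finite (Localization (X.hatPowers k σ)) (LocalizedModule (X.hatPowers k σ) M) :=
    Module.Finite.of_isLocalizedModule (X.hatPowers k σ)
      (LocalizedModule.mkLinearMap (X.hatPowers k σ) M)
  exact ⟨σ, hσ, isAssociatedPrime_of_quotient_annihilator (Localization (X.hatPowers k σ)) hPσ⟩

end Saturation

section VirtuallyCohenMacaulay

variable {ℳ : X.Pic → AddSubgroup M} [SetLike.GradedSMul (X.grading k) ℳ]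
  [DirectSum.Decomposition ℳ] {𝒩 : X.Pic → AddSubgroup N} [SetLike.GradedSMul (X.grading k) 𝒩]
  [DirectSum.Decomposition 𝒩]

theorem IsSaturated.annihilator_eq_saturation [Module.Finite (X.Cox k) M]
    (hN : X.IsSaturated k N) (hiso : X.SheafIso k 𝒩 ℳ) :
    Module.annihilator (X.Cox k) N = X.saturation k (Module.annihilator (X.Cox k) M) := by
  rw [hN.annihilator_eq, saturation_annihilator]
  exact iInf_congr fun σ => iInf_congr fun hσ =>
    (hiso.nonempty_linearEquiv_localizedModule hσ).some.annihilator_eq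

theorem IsSaturated.height_le_vdim_of_isAssociatedPrime (hN : X.IsSaturated k N)
    (hiso : X.SheafIso k 𝒩 ℳ) {P : Ideal (X.Cox k)} (hP : IsAssociatedPrime P N) :
    P.height ≤ X.vdim k ℳ := by
  obtain ⟨σ, hσ, hPσ⟩ :=
    (hN.isRelevant_of_isAssociatedPrime hP).exists_isAssociatedPrime_localizedModule hP
  obtain ⟨e⟩ := hiso.nonempty_linearEquiv_localizedModule hσ
  exact height_le_vdim hσ (e.isAssociatedPrime_iff.1 hPσ)

theorem unmixedIdeal_saturation_annihilator [Module.Finite (X.Cox k) M]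
    (hM : X.vdim k ℳ ≤ (Module.annihilator (X.Cox k) M).height) :
    UnmixedIdeal (X.saturation k (Module.annihilator (X.Cox k) M)) := by
  refine unmixedIdeal_of_forall_height_le fun P hP => ?_
  obtain ⟨σ, hσ, hPσ⟩ := exists_isAssociatedPrime_localizedModule_of_saturation hP
  exact (height_le_vdim hσ hPσ).trans (hM.trans (Ideal.height_mono (le_saturation _)))

end VirtuallyCohenMacaulay

end SmoothProjectiveFan

theorem mainTheorem8_general {n : ℕ} {ι : Type*} [Fintype ι] [DecidableEq ι]
    (X : SmoothProjectiveFan n ι) (k : Type*) [Field k]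
    (M : Type*) [AddCommGroup M] [Module (X.Cox k) M] [Module.Finite (X.Cox k) M]
    (ℳ : X.Pic → AddSubgroup M) [DirectSum.Decomposition ℳ] [SetLike.GradedSMul (X.grading k) ℳ]
    (hM : X.vdim k ℳ ≤ (Module.annihilator (X.Cox k) M).height) :
    (X.IsSaturated k M → ∀ P ∈ associatedPrimes (X.Cox k) M,
      ringKrullDim (X.Cox k ⧸ P) = Module.supportDim (X.Cox k) M) ∧
    X.IsVirtuallyUnmixed k ℳ := by
  have hrelevant (P) (hP : P ∈ associatedPrimes (X.Cox k) M) (hrel : X.IsRelevant k P) :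
      ringKrullDim (X.Cox k ⧸ P) = Module.supportDim (X.Cox k) M := by
    obtain ⟨σ, hσ, hPσ⟩ := hrel.exists_isAssociatedPrime_localizedModule hP
    exact ringKrullDim_quotient_eq_supportDim_of_height_le hP
      ((SmoothProjectiveFan.height_le_vdim hσ hPσ).trans hM)
  have hunmixed := SmoothProjectiveFan.unmixedIdeal_saturation_annihilator hM
  refine ⟨fun hs P hP => hrelevant P hP (hs.isRelevant_of_isAssociatedPrime hP), hrelevant,
    fun N _ _ 𝒩 _ _ hs hiso P hP => ?_, hunmixed, fun N _ _ 𝒩 _ _ hs hiso => ?_⟩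
  · refine ringKrullDim_quotient_eq_supportDim_of_height_le hP ?_
    calc P.height ≤ X.vdim k ℳ := hs.height_le_vdim_of_isAssociatedPrime hiso hP
      _ ≤ (Module.annihilator (X.Cox k) M).height := hM
      _ ≤ (Module.annihilator (X.Cox k) N).height := by
        rw [hs.annihilator_eq_saturation hiso]
        exact Ideal.height_mono (SmoothProjectiveFan.le_saturation _)
  · rw [hs.annihilator_eq_saturation hiso]
    exact hunmixed

theorem mainTheorem8 {n : ℕ} {ι : Type*} [Fintype ι] [DecidableEq ι]
    (X : SmoothProjectiveFan n ι) (k : Type*) [Field k] [IsAlgClosed k]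
    (M : Type*) [AddCommGroup M] [Module (X.Cox k) M] [Module.Finite (X.Cox k) M]
    (ℳ : X.Pic → AddSubgroup M) [DirectSum.Decomposition ℳ] [SetLike.GradedSMul (X.grading k) ℳ]
    (hM : X.IsVirtuallyCM k ℳ) :
    (X.IsSaturated k M → ∀ P ∈ associatedPrimes (X.Cox k) M,
      ringKrullDim (X.Cox k ⧸ P) = Module.supportDim (X.Cox k) M) ∧
    X.IsVirtuallyUnmixed k ℳ :=
  mainTheorem8_general X k M ℳ hM.2.le
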